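/- Let $d\ge 2$ and let $\Omega\subset\mathbb R^d$ be a bounded domain (a non-empty, bounded, connected open set) with Lebesgue measure $|\Omega|$. Let $-\Delta_\Omega^N$ be the Neumann Laplacian of $\Omega$, i.e. the non-negative self-adjoint operator on $L^2(\Omega)$ associated with the quadratic form $\int_\Omega|\nabla u|^2\,dx$ with form domain $H^1(\Omega)$. Assume that its spectrum is discrete (every point of the spectrum is an isolated point of the spectrum and an eigenvalue of finite multiplicity), and let $\mu_1\le\mu_2\le\cdots$ be its eigenvalues, repeated according to multiplicity. Put $\omega_d=\pi^{d/2}/\Gamma(1+d/2)$ and $C_d=4\pi^2\omega_d^{-2/d}$. Then the following hold. (1) For all positive integers $k$, $$\frac{d+2}{d}\,\frac1k\sum_{j=1}^k\mu_j-C_d\Big(\frac{k}{|\Omega|}\Big)^{2/d}\le -C_d\Big(\frac{k}{|\Omega|}\Big)^{2/d}\left(\frac{\mu_{k+1}}{C_d\,(k/|\Omega|)^{2/d}}-1\right)^2 .$$ (2) For all positive integers $k$, $$C_d\Big(\frac{k}{|\Omega|}\Big)^{2/d}x_-\le\mu_k\le\mu_{k+1}\le C_d\Big(\frac{k}{|\Omega|}\Big)^{2/d}x_+,\qquad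 x_\pm=1\pm\sqrt{1-\frac{\frac{d+2}{d}\frac1k\sum_{j=1}^k\mu_j}{C_d\,(k/|\Omega|)^{2/d}}},$$ where the quantity under the square root is non-negative. (3) For all $z>0$ the sum $\sum_j(z-\mu_j)_+$, where $(z-\mu_j)_+:=\max(z-\mu_j,0)$, is finite and $$\sum_{j}(z-\mu_j)_+\ge\frac{2}{d+2}\,C_d^{-d/2}\,|\Omega|\,z^{1+d/2}.$$ (4) For all $t>0$, $$\sum_{j=1}^\infty e^{-\mu_jt}\ge\frac{|\Omega|}{(4\pi t)^{d/2}},$$ where the left-hand side is allowed to be $+\infty$. -/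

import Mathlib

open MeasureTheory Set
open scoped ContDiff ENNReal

noncomputable section

/-! ### Unbounded operators on a Hilbert space: spectrum, discreteness, eigenvalue sequences -/

section Operators

variable {H : Type*} [NormedAddCommGroup H] [InnerProductSpace ℂ H]

/-- `z` is in the resolvent set of the (unbounded) operator `T`: the map `T - z`, from the domain
of `T` to `H`, is a bijection with a bounded inverse `R`. -/
def InResolventSet (T : H →ₗ.[ℂ] H) (z : ℂ) : Prop :=
  ∃ R : H →L[ℂ] H,
    (∀ f : H, ∃ h : R f ∈ T.domain, T ⟨R f, h⟩ - z • R f = f) ∧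
    (∀ u : T.domain, R (T u - z • (u : H)) = u)

/-- The spectrum of an unbounded operator. -/
def opSpectrum (T : H →ₗ.[ℂ] H) : Set ℂ := {z | ¬ InResolventSet T z}

/-- The eigenspace `ker (T - z)`: all `u` in the domain of `T` with `T u = z • u`. -/
def opEigenspace (T : H →ₗ.[ℂ] H) (z : ℂ) : Submodule ℂ H :=
  T.graph.comap (LinearMap.id.prod (z • LinearMap.id))

/-- The spectrum of `T` is discrete: every point of the spectrum is an isolated point of the
spectrum and an eigenvalue of finite multiplicity. -/
def HasDiscreteSpectrum (T : H →ₗ.[ℂ] H) : Prop :=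
  ∀ z ∈ opSpectrum T,
    (∃ ε > 0, ∀ w ∈ opSpectrum T, dist w z < ε → w = z) ∧
    opEigenspace T z ≠ ⊥ ∧ FiniteDimensional ℂ (opEigenspace T z)

/-- `μ 0 ≤ μ 1 ≤ …` lists the real eigenvalues of `T`, each one repeated according to its
multiplicity. -/
def IsEigenvalueSequence (T : H →ₗ.[ℂ] H) (μ : ℕ → ℝ) : Prop :=
  Monotone μ ∧
    ∀ x : ℝ, {j : ℕ | μ j = x}.encard = (Module.rank ℂ (opEigenspace T (x : ℂ))).toENat

lemma mem_opEigenspace_iff (T : H →ₗ.[ℂ] H) (z : ℂ) (u : H) :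
    u ∈ opEigenspace T z ↔ ∃ h : u ∈ T.domain, T ⟨u, h⟩ = z • u := by
  simp [opEigenspace, LinearPMap.mem_graph_iff]

end Operators

/-! ### The Neumann Laplacian of an open set -/

/-- The Hilbert space `L²(Ω)` of complex-valued functions, for the Lebesgue measure. -/
abbrev L2Space {d : ℕ} (Ω : Set (EuclideanSpace ℝ (Fin d))) : Type :=
  Lp ℂ 2 ((volume : Measure (EuclideanSpace ℝ (Fin d))).restrict Ω)

/-- The partial derivative `∂φ/∂xᵢ`. -/
def partialDeriv {d : ℕ} (i : Fin d) (φ : EuclideanSpace ℝ (Fin d) → ℝ)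
    (x : EuclideanSpace ℝ (Fin d)) : ℝ :=
  fderiv ℝ φ x (EuclideanSpace.single i 1)

/-- `φ ∈ C_c^∞(Ω)`. -/
structure IsTestFunction {d : ℕ} (Ω : Set (EuclideanSpace ℝ (Fin d)))
    (φ : EuclideanSpace ℝ (Fin d) → ℝ) : Prop where
  contDiff : ContDiff ℝ ∞ φ
  hasCompactSupport : HasCompactSupport φ
  tsupport_subset : tsupport φ ⊆ Ω

lemma IsTestFunction.continuous_partialDeriv {d : ℕ} {Ω : Set (EuclideanSpace ℝ (Fin d))}
    {φ : EuclideanSpace ℝ (Fin d) → ℝ} (hφ : IsTestFunction Ω φ) (i : Fin d) :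
    Continuous (partialDeriv i φ) :=
  (hφ.contDiff.continuous_fderiv (by simp)).clm_apply continuous_const

lemma IsTestFunction.integrable_smul {d : ℕ} {Ω : Set (EuclideanSpace ℝ (Fin d))}
    {φ : EuclideanSpace ℝ (Fin d) → ℝ} (hφ : IsTestFunction Ω φ) (u : L2Space Ω) :
    Integrable (fun x => φ x • u x) (volume.restrict Ω) :=
  memLp_one_iff_integrable.1 <| (Lp.memLp u).smul
    (hφ.contDiff.continuous.memLp_of_hasCompactSupport (p := 2) hφ.hasCompactSupport)

lemma IsTestFunction.integrable_partialDeriv_smul {d : ℕ} {Ω : Set (EuclideanSpace ℝ (Fin d))}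
    {φ : EuclideanSpace ℝ (Fin d) → ℝ} (hφ : IsTestFunction Ω φ) (i : Fin d) (u : L2Space Ω) :
    Integrable (fun x => partialDeriv i φ x • u x) (volume.restrict Ω) :=
  memLp_one_iff_integrable.1 <| (Lp.memLp u).smul
    ((hφ.continuous_partialDeriv i).memLp_of_hasCompactSupport (p := 2)
      (hφ.hasCompactSupport.fderiv_apply ℝ _))

/-- The graph of the weak gradient: all pairs `(u, g)` with `u ∈ H¹(Ω)` and `g = ∇u`, that is,
`u, g₁, …, g_d ∈ L²(Ω)` and `∫_Ω u ∂ᵢφ = - ∫_Ω gᵢ φ` for all `φ ∈ C_c^∞(Ω)` and all `i`. -/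
def weakGradientGraph {d : ℕ} (Ω : Set (EuclideanSpace ℝ (Fin d))) :
    Submodule ℂ (L2Space Ω × (Fin d → L2Space Ω)) where
  carrier := {p | ∀ (i : Fin d) (φ : EuclideanSpace ℝ (Fin d) → ℝ), IsTestFunction Ω φ →
    ∫ x in Ω, partialDeriv i φ x • p.1 x = - ∫ x in Ω, φ x • p.2 i x}
  zero_mem' := by
    intro i φ hφ
    have key : ∀ ψ : EuclideanSpace ℝ (Fin d) → ℝ, ∫ x in Ω, ψ x • (0 : L2Space Ω) x = 0 := by
      intro ψ
      refine integral_eq_zero_of_ae ?_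
      filter_upwards [Lp.coeFn_zero ℂ 2 (volume.restrict Ω)] with x hx
      rw [hx, Pi.zero_apply]
      exact smul_zero _
    simp only [Prod.fst_zero, Prod.snd_zero, Pi.zero_apply]
    rw [key, key, neg_zero]
  add_mem' := by
    rintro p q hp hq i φ hφ
    have key : ∀ (ψ : EuclideanSpace ℝ (Fin d) → ℝ) (u v : L2Space Ω),
        Integrable (fun x => ψ x • u x) (volume.restrict Ω) →
        Integrable (fun x => ψ x • v x) (volume.restrict Ω) →
        ∫ x in Ω, ψ x • (u + v) x = (∫ x in Ω, ψ x • u x) + ∫ x in Ω, ψ x • v x := by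
      intro ψ u v hu hv
      rw [← integral_add hu hv]
      refine integral_congr_ae ?_
      filter_upwards [Lp.coeFn_add u v] with x hx
      rw [hx, Pi.add_apply, smul_add]
    simp only [Prod.fst_add, Prod.snd_add, Pi.add_apply]
    rw [key _ _ _ (hφ.integrable_partialDeriv_smul i _) (hφ.integrable_partialDeriv_smul i _),
      key _ _ _ (hφ.integrable_smul _) (hφ.integrable_smul _), hp i φ hφ, hq i φ hφ, neg_add]
  smul_mem' := by
    rintro c p hp i φ hφ
    have key : ∀ (ψ : EuclideanSpace ℝ (Fin d) → ℝ) (u : L2Space Ω),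
        ∫ x in Ω, ψ x • (c • u) x = c * ∫ x in Ω, ψ x • u x := by
      intro ψ u
      rw [← integral_const_mul]
      refine integral_congr_ae ?_
      filter_upwards [Lp.coeFn_smul c u] with x hx
      rw [hx, Pi.smul_apply, smul_eq_mul, mul_smul_comm]
    simp only [Prod.smul_fst, Prod.smul_snd, Pi.smul_apply]
    rw [key, key, hp i φ hφ, mul_neg]

/-- The graph of the Neumann Laplacian: all pairs `(u, f)` with `u ∈ H¹(Ω)`, `f ∈ L²(Ω)` and
`∫_Ω ∇u · conj ∇w = ∫_Ω f conj w` for all `w ∈ H¹(Ω)`. -/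
def neumannGraph {d : ℕ} (Ω : Set (EuclideanSpace ℝ (Fin d))) : Submodule ℂ (L2Space Ω × L2Space Ω) where
  carrier := {p | ∃ g : Fin d → L2Space Ω, (p.1, g) ∈ weakGradientGraph Ω ∧
    ∀ q ∈ weakGradientGraph Ω, ∑ i, inner ℂ (q.2 i) (g i) = inner ℂ q.1 p.2}
  zero_mem' := ⟨0, (weakGradientGraph Ω).zero_mem, by simp⟩
  add_mem' := by
    rintro p q ⟨g, hg, hg'⟩ ⟨h, hh, hh'⟩
    refine ⟨g + h, (weakGradientGraph Ω).add_mem hg hh, fun r hr => ?_⟩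
    simp only [Pi.add_apply, inner_add_right, Finset.sum_add_distrib, hg' r hr, hh' r hr,
      Prod.snd_add]
  smul_mem' := by
    rintro c p ⟨g, hg, hg'⟩
    refine ⟨c • g, (weakGradientGraph Ω).smul_mem c hg, fun r hr => ?_⟩
    simp only [Pi.smul_apply, inner_smul_right, ← Finset.mul_sum, hg' r hr, Prod.smul_snd]

/-- The Neumann Laplacian `-Δ` of `Ω`, the self-adjoint operator on `L²(Ω)` associated with the
closed quadratic form `∫_Ω |∇u|²` with form domain `H¹(Ω)`. -/
def neumannLaplacian {d : ℕ} (Ω : Set (EuclideanSpace ℝ (Fin d))) : L2Space Ω →ₗ.[ℂ] L2Space Ω :=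
  (neumannGraph Ω).toLinearPMap

lemma L2Space.eq_zero_of_forall_testFunction {d : ℕ} {Ω : Set (EuclideanSpace ℝ (Fin d))}
    (hΩ : IsOpen Ω) (f : L2Space Ω)
    (h : ∀ φ : EuclideanSpace ℝ (Fin d) → ℝ, IsTestFunction Ω φ → ∫ x in Ω, φ x • f x = 0) :
    f = 0 := by
  rw [Lp.eq_zero_iff_ae_eq_zero]
  have hloc : LocallyIntegrableOn f Ω (volume.restrict Ω) :=
    ((Lp.memLp f).locallyIntegrable (by norm_num)).locallyIntegrableOn Ω
  have h1 := hΩ.ae_eq_zero_of_integral_contDiff_smul_eq_zero hloc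
    fun φ h1 h2 h3 => h φ ⟨h1, h2, h3⟩
  filter_upwards [h1, ae_restrict_mem hΩ.measurableSet] with x hx hxΩ
  exact hx hxΩ

/-- Test functions belong to `H¹(Ω)`. -/
lemma IsTestFunction.exists_mem_weakGradientGraph {d : ℕ} {Ω : Set (EuclideanSpace ℝ (Fin d))}
    {φ : EuclideanSpace ℝ (Fin d) → ℝ} (hφ : IsTestFunction Ω φ) :
    ∃ q ∈ weakGradientGraph Ω, q.1 =ᵐ[volume.restrict Ω] fun x => (φ x : ℂ) := by
  have hm : MemLp (fun x => (φ x : ℂ)) 2 (volume.restrict Ω) :=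
    (hφ.contDiff.continuous.memLp_of_hasCompactSupport hφ.hasCompactSupport).ofReal
  have hm' : ∀ i, MemLp (fun x => (partialDeriv i φ x : ℂ)) 2 (volume.restrict Ω) := fun i =>
    ((hφ.continuous_partialDeriv i).memLp_of_hasCompactSupport
      (hφ.hasCompactSupport.fderiv_apply ℝ _)).ofReal
  refine ⟨(hm.toLp _, fun i => (hm' i).toLp _), ?_, hm.coeFn_toLp⟩
  intro i ψ hψ
  have e1 : ∫ x in Ω, partialDeriv i ψ x • (hm.toLp _ : L2Space Ω) x
      = ∫ x in Ω, ((partialDeriv i ψ x * φ x : ℝ) : ℂ) := by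
    refine integral_congr_ae ?_
    filter_upwards [hm.coeFn_toLp] with x hx
    rw [hx, Complex.real_smul, Complex.ofReal_mul]
  have e2 : ∫ x in Ω, ψ x • ((hm' i).toLp _ : L2Space Ω) x
      = ∫ x in Ω, ((ψ x * partialDeriv i φ x : ℝ) : ℂ) := by
    refine integral_congr_ae ?_
    filter_upwards [(hm' i).coeFn_toLp] with x hx
    rw [hx, Complex.real_smul, Complex.ofReal_mul]
  have hzero : ∀ x ∉ Ω, φ x = 0 ∧ ψ x = 0 := fun x hx =>
    ⟨image_eq_zero_of_notMem_tsupport fun h => hx (hφ.tsupport_subset h),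
      image_eq_zero_of_notMem_tsupport fun h => hx (hψ.tsupport_subset h)⟩
  change ∫ x in Ω, partialDeriv i ψ x • (hm.toLp _ : L2Space Ω) x
    = - ∫ x in Ω, ψ x • ((hm' i).toLp _ : L2Space Ω) x
  rw [e1, e2, integral_complex_ofReal, integral_complex_ofReal,
    setIntegral_eq_integral_of_forall_compl_eq_zero (fun x hx => by rw [(hzero x hx).1, mul_zero]),
    setIntegral_eq_integral_of_forall_compl_eq_zero (fun x hx => by rw [(hzero x hx).2, zero_mul]),
    ← Complex.ofReal_neg]
  congr 1
  have c1 := hφ.contDiff.continuous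
  have c2 := hψ.contDiff.continuous
  have h := integral_mul_fderiv_eq_neg_fderiv_mul_of_integrable (μ := volume)
    (f := ψ) (g := φ) (v := EuclideanSpace.single i (1 : ℝ))
    (((hψ.continuous_partialDeriv i).mul c1).integrable_of_hasCompactSupport
      hφ.hasCompactSupport.mul_left)
    ((c2.mul (hφ.continuous_partialDeriv i)).integrable_of_hasCompactSupport
      hψ.hasCompactSupport.mul_right)
    ((c2.mul c1).integrable_of_hasCompactSupport hφ.hasCompactSupport.mul_left)
    (fun x _ => hψ.contDiff.differentiable (by simp) x)
    (fun x _ => hφ.contDiff.differentiable (by simp) x)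
  simp only [partialDeriv]
  rw [h, neg_neg]

/-- On an open set the Neumann Laplacian is well defined: `u` determines `f = -Δu`. -/
lemma neumannLaplacian_graph {d : ℕ} {Ω : Set (EuclideanSpace ℝ (Fin d))} (hΩ : IsOpen Ω) :
    (neumannLaplacian Ω).graph = neumannGraph Ω := by
  refine Submodule.toLinearPMap_graph_eq _ ?_
  rintro ⟨u, f⟩ ⟨g, hg, hgf⟩ hu
  simp only at hu hg hgf ⊢
  subst hu
  have hg0 : g = 0 := by
    funext i
    refine L2Space.eq_zero_of_forall_testFunction hΩ _ fun φ hφ => ?_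
    have h1 := hg i φ hφ
    have h2 := (weakGradientGraph Ω).zero_mem i φ hφ
    simp only [Prod.fst_zero, Prod.snd_zero, Pi.zero_apply] at h1 h2
    have h3 : ∫ x in Ω, φ x • (0 : L2Space Ω) x = 0 := by
      refine integral_eq_zero_of_ae ?_
      filter_upwards [Lp.coeFn_zero ℂ 2 (volume.restrict Ω)] with x hx
      rw [hx, Pi.zero_apply]
      exact smul_zero _
    rw [h2, h3, neg_zero, zero_eq_neg] at h1
    exact h1
  refine L2Space.eq_zero_of_forall_testFunction hΩ _ fun φ hφ => ?_
  obtain ⟨q, hq, hqφ⟩ := hφ.exists_mem_weakGradientGraph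
  have h := hgf q hq
  rw [hg0] at h
  simp only [Pi.zero_apply, inner_zero_right, Finset.sum_const_zero] at h
  rw [MeasureTheory.L2.inner_def] at h
  rw [h]
  refine integral_congr_ae ?_
  filter_upwards [hqφ] with x hx
  rw [hx]
  simp [mul_comm]

end

/-! ### The constants -/

/-- The volume `ω_d` of the unit ball of `ℝ^d`. -/
noncomputable def unitBallVolume (d : ℕ) : ℝ :=
  Real.pi ^ ((d : ℝ) / 2) / Real.Gamma (1 + (d : ℝ) / 2)

/-- The classical constant `C_d = 4π² ω_d^{-2/d}`. -/
noncomputable def classicalConst (d : ℕ) : ℝ :=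
  4 * Real.pi ^ 2 * unitBallVolume d ^ (-(2 / (d : ℝ)))

/-- The volume `|Ω|`. -/
noncomputable def vol {d : ℕ} (Ω : Set (EuclideanSpace ℝ (Fin d))) : ℝ := (volume Ω).toReal

/-- `C_d (k / |Ω|)^{2/d}`. -/
noncomputable def weylTerm {d : ℕ} (Ω : Set (EuclideanSpace ℝ (Fin d))) (k : ℕ) : ℝ :=
  classicalConst d * ((k : ℝ) / vol Ω) ^ (2 / (d : ℝ))

/-- The average `(1/k) (μ 0 + … + μ (k-1))` of the first `k` terms. -/
noncomputable def firstAverage (μ : ℕ → ℝ) (k : ℕ) : ℝ :=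
  (1 / (k : ℝ)) * ∑ j ∈ Finset.range k, μ j

/-- `1 - ((d+2)/d) (average of the first k eigenvalues) / (C_d (k/|Ω|)^{2/d})`. -/
noncomputable def krogerGap {d : ℕ} (Ω : Set (EuclideanSpace ℝ (Fin d))) (μ : ℕ → ℝ) (k : ℕ) : ℝ :=
  1 - ((d : ℝ) + 2) / d * firstAverage μ k / weylTerm Ω k

/-! Everything follows from an averaged variational principle tested on plane waves. Let `u j` be
orthonormal eigenfunctions for `μ j`. For each `z > 0` and each `w` in `H¹(Ω)`, `z ‖w‖² - ‖∇w‖² ≤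
∑_{μ j < z} (z - μ j) |⟨u j, w⟩|²` (`IsEigenvalueSequence.exists_variational`). On a bounded `Ω` the
plane wave of frequency `ξ` lies in `H¹(Ω)`, with `‖w‖² = |Ω|` and `‖∇w‖² = 4π²|ξ|²|Ω|`. By
Plancherel the integral of `|⟨u j, w⟩|²` over all `ξ` is `‖u j‖² = 1`. Integrating over `|ξ| < √z /
2π` gives the Riesz mean bound (3).

Taking `z` in `[μ (k-1), μ k]`, only the first `k` eigenvalues contribute to (3). Bernoulli's
inequality for the exponent `d/2 ≥ 1` then yields a quadratic inequality in `z / weylTerm Ω k`; the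
two endpoints give (1) and (2). The Laplace transform of (3) in `z` is (4).

The variational principle is proved without compactness of `ι : H¹(Ω) → L²(Ω)`. With the full `H¹`
norm on the form domain, `(T + 1)⁻¹ = ι ι†` is bounded and self-adjoint, and discreteness of the
spectrum of `T` makes its nonzero spectral points isolated. By the functional calculus these are
eigenvalues, so off the eigenvectors with eigenvalue above `β = (1 + z)⁻¹` the form of `ι ι†` is at
most `β`. -/

/-! ### Plancherel's theorem for integrable square-integrable functions -/

open scoped FourierTransform in
/-- The Fourier integral of an integrable, square-integrable function represents its
`L²` Fourier transform. -/
theorem MeasureTheory.Lp.coeFn_fourier_toLp {E : Type*} [NormedAddCommGroup E]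
    [InnerProductSpace ℝ E] [FiniteDimensional ℝ E] [MeasurableSpace E] [BorelSpace E]
    {f : E → ℂ} (h1 : Integrable f) (h2 : MemLp f 2) :
    (𝓕 (h2.toLp f) : Lp ℂ 2 (volume : Measure E)) =ᵐ[volume] 𝓕 f := by
  refine ae_eq_of_integral_contDiff_smul_eq
    ((Lp.memLp _).locallyIntegrable (by norm_num)) ?_ fun g hg hgc => ?_
  · exact (VectorFourier.fourierIntegral_continuous Real.continuous_fourierChar
      (by exact continuous_inner) h1).locallyIntegrable
  · have hgc' : HasCompactSupport fun x => (g x : ℂ) :=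
      hgc.comp_left (g := Complex.ofReal) Complex.ofReal_zero
    have hg' : ContDiff ℝ ∞ fun x => (g x : ℂ) := Complex.ofRealCLM.contDiff.comp hg
    set G : SchwartzMap E ℂ := hgc'.toSchwartzMap hg' with hG
    have hGx : ∀ x, G x = (g x : ℂ) := fun x => rfl
    -- The `L²` transform agrees with the distributional one, which moves `𝓕` onto the test
    -- function; the multiplication formula does the same for the Fourier integral.
    have key := congrArg (fun T => T G) (Lp.fourier_toTemperedDistribution_eq (h2.toLp f))
    simp only [TemperedDistribution.fourier_apply, Lp.toTemperedDistribution_apply] at key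
    have e1 : ∫ x, g x • (𝓕 (h2.toLp f) : Lp ℂ 2 (volume : Measure E)) x
        = ∫ x, G x • (𝓕 (h2.toLp f) : Lp ℂ 2 (volume : Measure E)) x := by
      refine integral_congr_ae (.of_forall fun x => ?_)
      simp [hGx]
    have e2 : ∫ x, g x • 𝓕 f x = ∫ x, G x • 𝓕 f x := by
      refine integral_congr_ae (.of_forall fun x => ?_)
      simp [hGx]
    rw [e1, e2, ← key]
    have e3 : ∫ x, (𝓕 G) x • (h2.toLp f) x = ∫ x, (𝓕 G) x • f x := by
      refine integral_congr_ae ?_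
      filter_upwards [h2.coeFn_toLp] with x hx
      rw [hx]
    rw [e3]
    have := VectorFourier.integral_fourierIntegral_smul_eq_flip (μ := (volume : Measure E))
      (ν := (volume : Measure E)) (L := innerₗ E) (f := fun x => G x) (g := f)
      Real.continuous_fourierChar (by exact continuous_inner) (G.integrable) h1
    rw [flip_innerₗ] at this
    exact this

open scoped FourierTransform in
/-- Plancherel's theorem for integrable, square-integrable functions. -/
theorem MeasureTheory.MemLp.eLpNorm_fourier_eq {E : Type*} [NormedAddCommGroup E]
    [InnerProductSpace ℝ E] [FiniteDimensional ℝ E] [MeasurableSpace E] [BorelSpace E]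
    {f : E → ℂ} (h2 : MemLp f 2) (h1 : Integrable f) :
    eLpNorm (𝓕 f) 2 volume = eLpNorm f 2 volume := by
  have h := Lp.norm_fourier_eq (h2.toLp f)
  rw [← eLpNorm_congr_ae (Lp.coeFn_fourier_toLp h1 h2), ← eLpNorm_congr_ae h2.coeFn_toLp,
    ← Lp.enorm_def, ← Lp.enorm_def, ← ofReal_norm, h, ofReal_norm]

/-! ### Self-adjoint operators whose spectrum is discrete above a level -/

section SelfAdjoint

variable {H : Type*} [NormedAddCommGroup H] [InnerProductSpace ℂ H] [CompleteSpace H]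

/-- An isolated point of the spectrum of a bounded self-adjoint operator is an eigenvalue. -/
theorem IsSelfAdjoint.exists_eigenvector_of_isolated {T : H →L[ℂ] H} (hT : IsSelfAdjoint T)
    {r : ℝ} (hr : r ∈ spectrum ℝ T) (hiso : ∃ ε > 0, ∀ s ∈ spectrum ℝ T, dist s r < ε → s = r) :
    ∃ v : H, v ≠ 0 ∧ T v = r • v := by
  obtain ⟨ε, hε, hiso⟩ := hiso
  -- The indicator of `{r}` is continuous on the spectrum because `r` is isolated. So `cfc f T` is
  -- the spectral projection at `r`: nonzero by spectral mapping, with range in the eigenspace since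
  -- `x * f x = r * f x`.
  let f : ℝ → ℝ := fun x => if x = r then 1 else 0
  have hf : ContinuousOn f (spectrum ℝ T) := by
    intro x hx
    by_cases hxr : x = r
    · subst hxr
      refine (continuousWithinAt_const (b := (1 : ℝ))).congr_of_eventuallyEq ?_ (by simp [f])
      filter_upwards [mem_nhdsWithin_of_mem_nhds (Metric.ball_mem_nhds x hε),
        self_mem_nhdsWithin] with y hy hys
      simp [f, hiso y hys hy]
    · refine (continuousWithinAt_const (b := (0 : ℝ))).congr_of_eventuallyEq ?_ (by simp [f, hxr])
      filter_upwards [mem_nhdsWithin_of_mem_nhds (isOpen_ne.mem_nhds hxr)] with y hy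
      simp only [f, if_neg (show y ≠ r from hy)]
  have hP : cfc f T ≠ 0 := by
    intro h0
    have h1 : (1 : ℝ) ∈ spectrum ℝ (cfc f T) := by
      rw [cfc_map_spectrum f T]
      exact ⟨r, hr, by simp [f]⟩
    rw [h0, spectrum.mem_iff, sub_zero] at h1
    exact h1 ((isUnit_one (M := ℝ)).map (algebraMap ℝ (H →L[ℂ] H)))
  have hTP : T * cfc f T = r • cfc f T := by
    nth_rewrite 1 [← cfc_id ℝ T]
    rw [← cfc_mul id f T, ← cfc_smul r f T]
    refine cfc_congr fun x _ => ?_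
    by_cases hx : x = r <;> simp [f, hx]
  obtain ⟨w, hw⟩ : ∃ w, cfc f T w ≠ 0 := by
    by_contra! h
    exact hP (ContinuousLinearMap.ext h)
  exact ⟨cfc f T w, hw, by simpa using congrArg (fun S : H →L[ℂ] H => S w) hTP⟩

/-- If the spectrum of a bounded self-adjoint operator is bounded by `β`, then so is its
quadratic form. -/
theorem IsSelfAdjoint.re_inner_le_of_spectrum_le {T : H →L[ℂ] H} (hT : IsSelfAdjoint T) {β : ℝ}
    (h : ∀ r ∈ spectrum ℝ T, r ≤ β) (v : H) : (inner ℂ v (T v)).re ≤ β * ‖v‖ ^ 2 := by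
  have h1 : T ≤ algebraMap ℝ (H →L[ℂ] H) β := le_algebraMap_of_spectrum_le h
  rw [ContinuousLinearMap.le_def] at h1
  have h2 := h1.inner_nonneg_right v
  have h3 := (Complex.le_def.1 h2).1
  simp only [Algebra.algebraMap_eq_smul_one, sub_apply, inner_sub_right,
    Complex.sub_re, smul_apply, one_apply_eq_self] at h3
  have h4 : (inner ℂ v ((β : ℂ) • v)).re = β * ‖v‖ ^ 2 := by
    rw [inner_smul_right, Complex.re_ofReal_mul]
    congr 1
    exact (norm_sq_eq_re_inner (𝕜 := ℂ) v).symm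
  rw [← Complex.coe_smul, h4, Complex.zero_re] at h3
  linarith

/-- Let `T` be a bounded self-adjoint operator all of whose spectral points above `β` are
isolated. On the orthogonal complement of the eigenvectors belonging to eigenvalues above `β`,
the quadratic form of `T` is bounded by `β`. -/
theorem IsSelfAdjoint.re_inner_le_of_orthogonal {T : H →L[ℂ] H} (hT : IsSelfAdjoint T) {β : ℝ}
    (hiso : ∀ r ∈ spectrum ℝ T, β < r → ∃ ε > 0, ∀ s ∈ spectrum ℝ T, dist s r < ε → s = r)
    {v : H} (hv : ∀ (r : ℝ) (e : H), β < r → T e = r • e → inner ℂ e v = 0) :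
    (inner ℂ v (T v)).re ≤ β * ‖v‖ ^ 2 := by
  let S : Set H := {e | ∃ r : ℝ, β < r ∧ T e = r • e}
  let V : Submodule ℂ H := (Submodule.span ℂ S)ᗮ
  have hVmem : ∀ w : H, w ∈ V ↔ ∀ e ∈ S, inner ℂ e w = 0 := by
    intro w
    refine ⟨fun h e he => h e (Submodule.subset_span he), fun h e he => ?_⟩
    induction he using Submodule.span_induction with
    | mem x hx => exact h x hx
    | zero => simp
    | add x y _ _ hx hy => rw [inner_add_left, hx, hy, add_zero]
    | smul a x _ hx => rw [inner_smul_left, hx, mul_zero]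
  have hsymm : ∀ x y, inner ℂ (T x) y = inner ℂ x (T y) := hT.isSymmetric
  have hTV : ∀ w ∈ V, T w ∈ V := by
    intro w hw
    rw [hVmem] at hw ⊢
    rintro e ⟨r, hr, he⟩
    rw [← hsymm, he, ← Complex.coe_smul, inner_smul_left, hw e ⟨r, hr, he⟩, mul_zero]
  let TV := T.restrict hTV
  have hTVsa : IsSelfAdjoint TV := by
    rw [ContinuousLinearMap.isSelfAdjoint_iff_isSymmetric]
    intro x y
    exact hsymm x y
  -- For a merely invariant subspace this inclusion could fail; here the inverse `R` of `r - T` also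
  -- preserves `V`. Indeed `T e = s • e` gives `(r - s) ⟨e, R w⟩ = ⟨e, w⟩ = 0`, and `r = s` would
  -- force `e = 0`.
  have hspec : spectrum ℝ TV ⊆ spectrum ℝ T := by
    intro r hr hr'
    rw [spectrum.mem_iff] at hr
    refine hr ?_
    obtain ⟨U, hU⟩ := (hr' : IsUnit (algebraMap ℝ (H →L[ℂ] H) r - T))
    let R : H →L[ℂ] H := ↑U⁻¹
    have hUx : ∀ x, (U : H →L[ℂ] H) x = r • x - T x := by
      intro x
      rw [hU]
      simp [Algebra.algebraMap_eq_smul_one]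
    have hUR : ∀ x, r • R x - T (R x) = x := by
      intro x
      rw [← hUx]
      exact congrArg (fun A : H →L[ℂ] H => A x) U.mul_inv
    have hRU : ∀ x, R (r • x - T x) = x := by
      intro x
      rw [← hUx]
      exact congrArg (fun A : H →L[ℂ] H => A x) U.inv_mul
    have hRV : ∀ w ∈ V, R w ∈ V := by
      intro w hw
      rw [hVmem] at hw ⊢
      rintro e ⟨s, hs, he⟩
      have h1 := hw e ⟨s, hs, he⟩
      rw [← hUR w, inner_sub_right, ← hsymm, he, ← Complex.coe_smul, ← Complex.coe_smul,
        inner_smul_left, inner_smul_right, ← sub_mul, mul_eq_zero] at h1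
      by_cases he0 : e = 0
      · rw [he0, inner_zero_left]
      refine h1.resolve_left fun h2 => he0 ?_
      have h3 : r = s := by
        simp only [Complex.conj_ofReal, sub_eq_zero] at h2
        exact_mod_cast h2
      have := hRU e
      rw [he, h3, sub_self, map_zero] at this
      exact this.symm
    refine ⟨⟨algebraMap ℝ (V →L[ℂ] V) r - TV, R.restrict hRV, ?_, ?_⟩, rfl⟩
    · ext x
      simpa [Algebra.algebraMap_eq_smul_one, TV] using hUR x
    · ext x
      simpa [Algebra.algebraMap_eq_smul_one, TV] using hRU x
  -- A spectral point above `β` would be isolated, hence have an eigenvector in `V`, which would be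
  -- orthogonal to itself.
  have hle : ∀ r ∈ spectrum ℝ TV, r ≤ β := by
    intro r hr
    by_contra! hβ
    obtain ⟨ε, hε, h⟩ := hiso r (hspec hr) hβ
    obtain ⟨x, hx0, hx⟩ := hTVsa.exists_eigenvector_of_isolated hr
      ⟨ε, hε, fun s hs => h s (hspec hs)⟩
    have hx' : T x = r • (x : H) := congrArg Subtype.val hx
    have := (hVmem x).1 x.2 x ⟨r, hβ, hx'⟩
    rw [inner_self_eq_zero] at this
    exact hx0 (Subtype.ext this)
  exact hTVsa.re_inner_le_of_spectrum_le hle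
    ⟨v, (hVmem v).2 fun e ⟨r, hr, he⟩ => hv r e hr he⟩

end SelfAdjoint

/-! ### Variational bounds on the form domain. -/

section FormDomain

lemma inner_self_eq_ofReal_norm_sq {H : Type*} [NormedAddCommGroup H] [InnerProductSpace ℂ H]
    (x : H) : inner ℂ x x = ((‖x‖ ^ 2 : ℝ) : ℂ) :=
  (inner_self_eq_norm_sq_to_K x).trans (by push_cast; rfl)

variable {H K : Type*} [NormedAddCommGroup H] [InnerProductSpace ℂ H] [CompleteSpace H]
  [NormedAddCommGroup K] [InnerProductSpace ℂ K] [CompleteSpace K]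

open ContinuousLinearMap in
/-- Variational bound on the orthogonal complement of the eigenvectors of `ι ι†` belonging to
eigenvalues above `β`. -/
theorem norm_sq_le_of_orthogonal (ι : K →L[ℂ] H) {β : ℝ} (hβ : 0 < β)
    (hiso : ∀ r ∈ spectrum ℝ (ι ∘L adjoint ι), β < r →
      ∃ ε > 0, ∀ s ∈ spectrum ℝ (ι ∘L adjoint ι), dist s r < ε → s = r)
    {v : K} (hv : ∀ (r : ℝ) (e : H), β < r → ι (adjoint ι e) = r • e → inner ℂ e (ι v) = 0) :
    ‖ι v‖ ^ 2 ≤ β * ‖v‖ ^ 2 := by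
  have hsa : IsSelfAdjoint (ι ∘L adjoint ι) := by
    rw [isSelfAdjoint_iff_isSymmetric]
    intro x y
    change inner ℂ (ι (adjoint ι x)) y = inner ℂ x (ι (adjoint ι y))
    rw [← adjoint_inner_right, adjoint_inner_left]
  have h1 := hsa.re_inner_le_of_orthogonal hiso (v := ι v) hv
  have h2 : (inner ℂ (ι v) ((ι ∘L adjoint ι) (ι v))).re = ‖adjoint ι (ι v)‖ ^ 2 := by
    change (inner ℂ (ι v) (ι (adjoint ι (ι v)))).re = _
    rw [← adjoint_inner_left, inner_self_eq_ofReal_norm_sq, Complex.ofReal_re]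
  -- The form of `ι ι†` at `ι v` is `‖ι† ι v‖²`, so `h1` bounds it by `β ‖ι v‖²`. Cauchy–Schwarz for
  -- `‖ι v‖² = ⟨ι† ι v, v⟩` then trades `ι† ι v` for `v`, after division by `‖ι v‖²`.
  have h3 : ‖ι v‖ ^ 2 ≤ ‖adjoint ι (ι v)‖ * ‖v‖ := by
    have h4 : inner ℂ (adjoint ι (ι v)) v = ((‖ι v‖ ^ 2 : ℝ) : ℂ) := by
      rw [adjoint_inner_left, inner_self_eq_ofReal_norm_sq]
    have h5 := norm_inner_le_norm (𝕜 := ℂ) (adjoint ι (ι v)) v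
    rwa [h4, Complex.norm_of_nonneg (by positivity)] at h5
  rw [h2] at h1
  rcases (norm_nonneg (ι v)).eq_or_lt with h0 | h0
  · rw [← h0, zero_pow two_ne_zero]; positivity
  have h6 : (‖ι v‖ ^ 2) ^ 2 ≤ β * ‖ι v‖ ^ 2 * ‖v‖ ^ 2 := by
    calc (‖ι v‖ ^ 2) ^ 2 ≤ (‖adjoint ι (ι v)‖ * ‖v‖) ^ 2 := by gcongr
      _ = ‖adjoint ι (ι v)‖ ^ 2 * ‖v‖ ^ 2 := mul_pow _ _ _
      _ ≤ _ := by gcongr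
  have h7 : 0 < ‖ι v‖ ^ 2 := by positivity
  nlinarith

open ContinuousLinearMap in
/-- Averaged variational principle for one trial vector: `u` is an orthonormal basis of the span of
the eigenvectors of `ι ι†` belonging to eigenvalues above `β`. -/
theorem norm_sq_sub_sum_le (ι : K →L[ℂ] H) {β : ℝ} (hβ : 0 < β)
    (hiso : ∀ r ∈ spectrum ℝ (ι ∘L adjoint ι), β < r →
      ∃ ε > 0, ∀ s ∈ spectrum ℝ (ι ∘L adjoint ι), dist s r < ε → s = r)
    {J : Type*} [Fintype J] {u : J → H} (hu : Orthonormal ℂ u) {l : J → ℝ} (hl : ∀ j, l j ≠ 0)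
    (hul : ∀ j, ι (adjoint ι (u j)) = l j • u j)
    (hspan : ∀ (r : ℝ) (e : H), β < r → ι (adjoint ι e) = r • e →
      e ∈ Submodule.span ℂ (Set.range u)) (w : K) :
    ‖ι w‖ ^ 2 - ∑ j, ‖inner ℂ (u j) (ι w)‖ ^ 2
      ≤ β * (‖w‖ ^ 2 - ∑ j, (l j)⁻¹ * ‖inner ℂ (u j) (ι w)‖ ^ 2) := by
  classical
  set c : J → ℂ := fun j => inner ℂ (u j) (ι w) with hc
  -- The vectors `ι† (u j)` are orthogonal in `K` with squared norms `l j`, and `s` is the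
  -- projection of `w` onto their span. At the same time `ι s` is the projection of `ι w` onto the
  -- span of `u`, so both squared norms split by Pythagoras and only `w - s` remains.
  let s : K := ∑ j, c j • ((l j : ℂ)⁻¹ • adjoint ι (u j))
  have hlc : ∀ j, (l j : ℂ) ≠ 0 := fun j => Complex.ofReal_ne_zero.2 (hl j)
  have hιs : ι s = ∑ j, c j • u j := by
    simp only [s, map_sum, map_smul, hul, ← Complex.coe_smul]
    refine Finset.sum_congr rfl fun j _ => ?_
    rw [inv_smul_smul₀ (hlc j)]
  have hus : ∀ j, inner ℂ (u j) (ι s) = c j := by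
    intro j
    rw [hιs, hu.inner_right_fintype]
  have huv : ∀ j, inner ℂ (u j) (ι (w - s)) = 0 := by
    intro j
    rw [map_sub, inner_sub_right, hus, sub_self]
  have hsx : ∀ x : K, inner ℂ s x
      = ∑ j, starRingEnd ℂ (c j) * ((l j : ℂ)⁻¹ * inner ℂ (u j) (ι x)) := by
    intro x
    simp only [s, sum_inner, inner_smul_left, adjoint_inner_left, map_inv₀, Complex.conj_ofReal]
  have hss : ‖s‖ ^ 2 = ∑ j, (l j)⁻¹ * ‖c j‖ ^ 2 := by
    have h := hsx s
    rw [inner_self_eq_ofReal_norm_sq] at h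
    have h' : ((‖s‖ ^ 2 : ℝ) : ℂ) = ((∑ j, (l j)⁻¹ * ‖c j‖ ^ 2 : ℝ) : ℂ) := by
      rw [h]
      push_cast
      refine Finset.sum_congr rfl fun j _ => ?_
      rw [hus, ← Complex.conj_mul' (c j)]
      ring
    exact_mod_cast h'
  have hsv : inner ℂ s (w - s) = 0 := by
    rw [hsx]
    exact Finset.sum_eq_zero fun j _ => by rw [huv, mul_zero, mul_zero]
  have hw : ‖w‖ ^ 2 = ‖s‖ ^ 2 + ‖w - s‖ ^ 2 := by
    have := norm_add_sq_eq_norm_sq_add_norm_sq_of_inner_eq_zero s (w - s) hsv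
    rw [add_sub_cancel] at this
    simpa [sq] using this
  have hιsv : inner ℂ (ι s) (ι (w - s)) = 0 := by
    rw [hιs, sum_inner]
    exact Finset.sum_eq_zero fun j _ => by rw [inner_smul_left, huv, mul_zero]
  have hιss : ‖ι s‖ ^ 2 = ∑ j, ‖c j‖ ^ 2 := by
    have h : inner ℂ (ι s) (ι s) = ((∑ j, ‖c j‖ ^ 2 : ℝ) : ℂ) := by
      conv_lhs => arg 2; rw [hιs]
      rw [sum_inner]
      push_cast
      refine Finset.sum_congr rfl fun j _ => ?_
      rw [inner_smul_left, hus, ← Complex.conj_mul' (c j)]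
    rw [inner_self_eq_ofReal_norm_sq] at h
    exact_mod_cast h
  have hιw : ‖ι w‖ ^ 2 = ‖ι s‖ ^ 2 + ‖ι (w - s)‖ ^ 2 := by
    have := norm_add_sq_eq_norm_sq_add_norm_sq_of_inner_eq_zero (ι s) (ι (w - s)) hιsv
    rw [← map_add, add_sub_cancel] at this
    simpa [sq] using this
  have hmain : ‖ι (w - s)‖ ^ 2 ≤ β * ‖w - s‖ ^ 2 := by
    refine norm_sq_le_of_orthogonal ι hβ hiso fun r e hr he => ?_
    have hmem := hspan r e hr he
    clear he
    induction hmem using Submodule.span_induction with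
    | mem x hx => obtain ⟨j, rfl⟩ := hx; exact huv j
    | zero => simp
    | add x y _ _ hx hy => rw [inner_add_left, hx, hy, add_zero]
    | smul a x _ hx => rw [inner_smul_left, hx, mul_zero]
  have h1 : ‖ι w‖ ^ 2 - ∑ j, ‖c j‖ ^ 2 = ‖ι (w - s)‖ ^ 2 := by rw [hιw, hιss]; ring
  have h2 : ‖w‖ ^ 2 - ∑ j, (l j)⁻¹ * ‖c j‖ ^ 2 = ‖w - s‖ ^ 2 := by rw [hw, hss]; ring
  rw [h1, h2]
  exact hmain

end FormDomain

/-! ### The operator associated with a closed form -/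

section FormOperator

open ContinuousLinearMap

variable {H K : Type*} [NormedAddCommGroup H] [InnerProductSpace ℂ H]
  [NormedAddCommGroup K] [InnerProductSpace ℂ K]

/-- `p = (u, f)` belongs to the graph of the operator `T` associated with the form
`‖w‖² - ‖ι w‖²`, where `ι` embeds the form domain into `H`: the equation `T u = f` holds weakly. -/
def IsWeakSolution (ι : K →L[ℂ] H) (p : H × H) : Prop :=
  ∃ w : K, ι w = p.1 ∧ ∀ v : K, inner ℂ v w = inner ℂ (ι v) (p.2 + p.1)

variable {ι : K →L[ℂ] H} {T : H →ₗ.[ℂ] H}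

lemma mem_opEigenspace_iff_isWeakSolution (hT : ∀ p, p ∈ T.graph ↔ IsWeakSolution ι p)
    {z : ℂ} {u : H} :
    u ∈ opEigenspace T z ↔ IsWeakSolution ι (u, z • u) := by
  rw [← hT]
  rfl

/-- Testing the weak equation with the solution itself gives `‖w‖² = (x + 1) ‖u‖²`, while `‖u‖ = ‖ι
w‖ ≤ ‖w‖`. -/
lemma nonneg_of_opEigenspace_ne_bot (hT : ∀ p, p ∈ T.graph ↔ IsWeakSolution ι p)
    (hι : ∀ w, ‖ι w‖ ≤ ‖w‖) {x : ℝ}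
    (hx : opEigenspace T (x : ℂ) ≠ ⊥) : 0 ≤ x := by
  obtain ⟨u, hu, hu0⟩ := Submodule.exists_mem_ne_zero_of_ne_bot hx
  obtain ⟨w, hw, h⟩ := (mem_opEigenspace_iff_isWeakSolution hT).1 hu
  have h1 := h w
  simp only at hw
  rw [hw, inner_add_right, inner_smul_right, inner_self_eq_ofReal_norm_sq,
    inner_self_eq_ofReal_norm_sq] at h1
  have h2 : ‖w‖ ^ 2 = x * ‖u‖ ^ 2 + ‖u‖ ^ 2 := by exact_mod_cast h1
  have h3 : ‖u‖ ^ 2 ≤ ‖w‖ ^ 2 := by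
    rw [← hw]
    exact pow_le_pow_left₀ (norm_nonneg _) (hι w) 2
  have h4 : 0 ≤ x * ‖u‖ ^ 2 := by linarith
  exact nonneg_of_mul_nonneg_left h4 (by positivity)

lemma mem_opSpectrum_of_opEigenspace_ne_bot {z : ℂ} (hz : opEigenspace T z ≠ ⊥) :
    z ∈ opSpectrum T := by
  rintro ⟨R, -, hR⟩
  obtain ⟨u, hu, hu0⟩ := Submodule.exists_mem_ne_zero_of_ne_bot hz
  obtain ⟨h, hu'⟩ := (mem_opEigenspace_iff T z u).1 hu
  have := hR ⟨u, h⟩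
  rw [hu', sub_self, map_zero] at this
  exact hu0 this.symm

variable [CompleteSpace H] [CompleteSpace K]

variable (ι) in
/-- The resolvent `(T + 1)⁻¹` of the operator associated with the form. -/
noncomputable def formResolvent : H →L[ℂ] H := ι ∘L adjoint ι

/-- The weak equation says exactly that `w` is the Riesz representative `ι† (f + u)`. This
identifies `ι ι†` with `(T + 1)⁻¹`. -/
lemma isWeakSolution_iff {u f : H} : IsWeakSolution ι (u, f) ↔ formResolvent ι (f + u) = u := by
  constructor
  · rintro ⟨w, hw, h⟩
    have : adjoint ι (f + u) = w := by
      refine ext_inner_left ℂ fun v => ?_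
      rw [adjoint_inner_right]
      exact (h v).symm
    change ι (adjoint ι (f + u)) = u
    rw [this]
    exact hw
  · exact fun h => ⟨adjoint ι (f + u), h, fun v => adjoint_inner_right _ _ _⟩

lemma IsWeakSolution.formResolvent_add {p : H × H} (hp : IsWeakSolution ι p) :
    formResolvent ι (p.2 + p.1) = p.1 :=
  isWeakSolution_iff.1 hp

lemma isWeakSolution_formResolvent (f : H) :
    IsWeakSolution ι (formResolvent ι f, f - formResolvent ι f) := by
  rw [isWeakSolution_iff, sub_add_cancel]

lemma mem_opEigenspace_iff_formResolvent (hT : ∀ p, p ∈ T.graph ↔ IsWeakSolution ι p)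
    {x r : ℝ} (hx : (1 + x) * r = 1)
    {u : H} :
    u ∈ opEigenspace T (x : ℂ) ↔ formResolvent ι u = r • u := by
  have hr : (r : ℂ) ≠ 0 := Complex.ofReal_ne_zero.2 (right_ne_zero_of_mul_eq_one hx)
  have hx' : (1 + (x : ℂ)) = (r : ℂ)⁻¹ := by
    refine eq_inv_of_mul_eq_one_left ?_
    exact_mod_cast hx
  rw [mem_opEigenspace_iff_isWeakSolution hT, isWeakSolution_iff,
    show (x : ℂ) • u + u = (r : ℂ)⁻¹ • u by rw [← hx', add_smul, one_smul, add_comm],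
    map_smul, inv_smul_eq_iff₀ hr, Complex.coe_smul]

/-- Writing `B = (T + 1)⁻¹` and `c = 1 + x = r⁻¹`, one has `r - B = r B (T - x)`, so invertibility
of `T - x` passes to `r - B`. This carries isolation of spectral points from `T` to its resolvent.
-/
lemma mem_opSpectrum_of_mem_spectrum_formResolvent (hT : ∀ p, p ∈ T.graph ↔ IsWeakSolution ι p)
    {x r : ℝ}
    (hx : (1 + x) * r = 1) (hr : r ∈ spectrum ℝ (formResolvent ι)) :
    (x : ℂ) ∈ opSpectrum (T) := by
  rintro ⟨R, hR1, hR2⟩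
  refine hr ?_
  have hgraph : ∀ u (h : u ∈ (T).domain),
      IsWeakSolution ι (u, T ⟨u, h⟩) := fun u h =>
    (hT _).1 (T.mem_graph ⟨u, h⟩)
  have hBR : ∀ f, formResolvent ι (f + (1 + x : ℂ) • R f) = R f := by
    intro f
    obtain ⟨h, hf⟩ := hR1 f
    have h1 := (hgraph _ h).formResolvent_add
    rw [sub_eq_iff_eq_add] at hf
    simp only [hf] at h1
    rwa [add_smul, one_smul, add_comm (R f), ← add_assoc]
  have hRB : ∀ f, R (f - (1 + x : ℂ) • formResolvent ι f) = formResolvent ι f := by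
    intro f
    have h1 := isWeakSolution_formResolvent (ι := ι) f
    rw [← hT, LinearPMap.mem_graph_iff] at h1
    obtain ⟨y, hy1, hy2⟩ := h1
    have h2 := hR2 y
    simp only at hy1 hy2
    rw [hy2, hy1] at h2
    rwa [add_smul, one_smul, ← sub_sub]
  have hc : ((1 + x : ℂ)) * r = 1 := by exact_mod_cast hx
  set c : ℂ := 1 + x with hcdef
  have hcc : ∀ f : H, (r : ℂ) • c • f = f := by
    intro f
    rw [smul_smul, mul_comm, hc, one_smul]
  -- The inverse of `r B (T - x)` is `c (T + 1) R`, and `(T + 1) R = 1 + c R`.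
  refine ⟨⟨algebraMap ℝ _ r - formResolvent ι, c • (1 + c • R), ?_, ?_⟩, rfl⟩
  · ext1 f
    change r • (c • (f + c • R f)) - formResolvent ι (c • (f + c • R f)) = f
    rw [map_smul, hBR, ← Complex.coe_smul, hcc, add_sub_cancel_right]
  · ext1 f
    change c • ((r • f - formResolvent ι f) + c • R (r • f - formResolvent ι f)) = f
    have h1 : (r : ℂ) • f - formResolvent ι f = (r : ℂ) • (f - c • formResolvent ι f) := by
      rw [smul_sub, hcc]
    have h2 : c • (r : ℂ) • f = f := by rw [smul_smul, hc, one_smul]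
    rw [← Complex.coe_smul, h1, map_smul, hRB, smul_comm c (r : ℂ), hcc, ← h1, sub_add_cancel, h2]

end FormOperator

/-! ### Eigenvalue sequences and the averaged variational principle. -/

section EigenvalueSequence

open Filter Topology

lemma IsEigenvalueSequence.opEigenspace_ne_bot {H : Type*} [NormedAddCommGroup H]
    [InnerProductSpace ℂ H] {T : H →ₗ.[ℂ] H} {μ : ℕ → ℝ} (hμ : IsEigenvalueSequence T μ) (j : ℕ) :
    opEigenspace T (μ j : ℂ) ≠ ⊥ := by
  intro h
  have h1 := hμ.2 (μ j)
  rw [h, rank_bot, map_zero, encard_eq_zero] at h1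
  exact (h1 ▸ (rfl : μ j = μ j) : j ∈ (∅ : Set ℕ))

lemma HasDiscreteSpectrum.finiteDimensional_opEigenspace {H : Type*} [NormedAddCommGroup H]
    [InnerProductSpace ℂ H] {T : H →ₗ.[ℂ] H} (hT : HasDiscreteSpectrum T) (z : ℂ) :
    FiniteDimensional ℂ (opEigenspace T z) := by
  by_cases h : opEigenspace T z = ⊥
  · rw [h]; infer_instance
  · exact (hT z (mem_opSpectrum_of_opEigenspace_ne_bot h)).2.2

/-- Each eigenspace has an orthonormal basis indexed by the occurrences of its eigenvalue. -/
lemma IsEigenvalueSequence.exists_orthonormalBasis {H : Type*} [NormedAddCommGroup H]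
    [InnerProductSpace ℂ H] {T : H →ₗ.[ℂ] H} {μ : ℕ → ℝ} (hμ : IsEigenvalueSequence T μ)
    (hT : HasDiscreteSpectrum T) (x : ℝ) :
    {j | μ j = x}.Finite ∧ ∃ v : ℕ → H, (∀ j, μ j = x → v j ∈ opEigenspace T (x : ℂ)) ∧
      (∀ i j, μ i = x → μ j = x → inner ℂ (v i) (v j) = if i = j then 1 else 0) ∧
      opEigenspace T (x : ℂ) ≤ Submodule.span ℂ (v '' {j | μ j = x}) := by
  have := hT.finiteDimensional_opEigenspace x
  have h1 := hμ.2 x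
  rw [← Module.finrank_eq_rank, map_natCast] at h1
  have hfin : {j | μ j = x}.Finite := finite_of_encard_eq_coe h1
  refine ⟨hfin, ?_⟩
  have := hfin.fintype
  have hcard : Fintype.card {j | μ j = x} = Module.finrank ℂ (opEigenspace T (x : ℂ)) := by
    rw [← toFinset_card]
    rw [encard_eq_coe_toFinset_card] at h1
    exact_mod_cast h1
  let e : {j | μ j = x} ≃ Fin (Module.finrank ℂ (opEigenspace T (x : ℂ))) :=
    Fintype.equivFinOfCardEq hcard
  let b := (stdOrthonormalBasis ℂ (opEigenspace T (x : ℂ))).reindex e.symm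
  classical
  refine ⟨fun j => if h : μ j = x then b ⟨j, h⟩ else 0, fun j hj => ?_, fun i j hi hj => ?_, ?_⟩
  · simp only [hj, dif_pos, SetLike.coe_mem]
  · simp only [hi, hj, dif_pos]
    rw [← Submodule.coe_inner, orthonormal_iff_ite.1 b.orthonormal]
    simp
  · intro w hw
    have h2 := b.sum_repr ⟨w, hw⟩
    have h3 := congrArg Subtype.val h2
    rw [Submodule.coe_sum] at h3
    simp only at h3
    rw [← h3]
    refine Submodule.sum_mem _ fun j _ => Submodule.smul_mem _ _ (Submodule.subset_span ?_)
    exact ⟨j, j.2, by simp [show μ j = x from j.2]⟩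

variable {H K : Type*} [NormedAddCommGroup H] [InnerProductSpace ℂ H] [CompleteSpace H]
  [NormedAddCommGroup K] [InnerProductSpace ℂ K] [CompleteSpace K]
  {ι : K →L[ℂ] H} {T : H →ₗ.[ℂ] H} {μ : ℕ → ℝ}

lemma IsEigenvalueSequence.inv_mem_spectrum (hμ : IsEigenvalueSequence T μ)
    (hT : ∀ p, p ∈ T.graph ↔ IsWeakSolution ι p) (hι : ∀ w, ‖ι w‖ ≤ ‖w‖) (j : ℕ) :
    (1 + μ j)⁻¹ ∈ spectrum ℝ (formResolvent ι) := by
  have h0 := nonneg_of_opEigenspace_ne_bot hT hι (hμ.opEigenspace_ne_bot j)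
  obtain ⟨u, hu, hu0⟩ := Submodule.exists_mem_ne_zero_of_ne_bot (hμ.opEigenspace_ne_bot j)
  rw [mem_opEigenspace_iff_formResolvent hT (r := (1 + μ j)⁻¹)
    (mul_inv_cancel₀ (by positivity))] at hu
  intro h
  obtain ⟨U, hU⟩ := (h : IsUnit (algebraMap ℝ (H →L[ℂ] H) (1 + μ j)⁻¹ - formResolvent ι))
  refine hu0 ?_
  have h1 : ((U⁻¹ : (H →L[ℂ] H)ˣ) : H →L[ℂ] H) ((U : H →L[ℂ] H) u) = u :=
    congrArg (fun A : H →L[ℂ] H => A u) U.inv_mul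
  rw [← h1, hU]
  simp [Algebra.algebraMap_eq_smul_one, hu]

/-- Only finitely many eigenvalues lie below a given level. -/
theorem IsEigenvalueSequence.finite_lt (hμ : IsEigenvalueSequence T μ)
    (hT : ∀ p, p ∈ T.graph ↔ IsWeakSolution ι p) (hι : ∀ w, ‖ι w‖ ≤ ‖w‖)
    (hdisc : HasDiscreteSpectrum T) (z : ℝ) : {j | μ j < z}.Finite := by
  -- Otherwise `μ` is bounded and converges to some `L`. The spectrum of the bounded resolvent is
  -- closed, so it contains `(1 + L)⁻¹` and `L` is in the spectrum of `T`. Isolation makes `μ`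
  -- eventually equal to `L`, contradicting finite multiplicity.
  by_contra hinf
  have hall : ∀ n, μ n < z := by
    intro n
    obtain ⟨m, hm, hnm⟩ := (show {j | μ j < z}.Infinite from hinf).exists_gt n
    exact (hμ.1 hnm.le).trans_lt hm
  have hpos : ∀ j, 0 ≤ μ j := fun j =>
    nonneg_of_opEigenspace_ne_bot hT hι (hμ.opEigenspace_ne_bot j)
  have hlim := tendsto_atTop_ciSup hμ.1 ⟨z, by rintro _ ⟨n, rfl⟩; exact (hall n).le⟩
  set L := ⨆ i, μ i
  have hL : 0 ≤ L := ge_of_tendsto' hlim hpos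
  have hspec : (1 + L)⁻¹ ∈ spectrum ℝ (formResolvent ι) :=
    (spectrum.isClosed (𝕜 := ℝ) (formResolvent ι)).mem_of_tendsto
      ((hlim.const_add 1).inv₀ (by positivity)) (.of_forall fun j => hμ.inv_mem_spectrum hT hι j)
  have hLs := mem_opSpectrum_of_mem_spectrum_formResolvent hT
    (mul_inv_cancel₀ (by positivity : 1 + L ≠ 0)) hspec
  obtain ⟨⟨ε, hε, h⟩, -⟩ := hdisc _ hLs
  have hev : ∀ᶠ j in atTop, μ j = L := by
    filter_upwards [(Metric.tendsto_nhds.1 hlim) ε hε] with j hj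
    have := h (μ j) (mem_opSpectrum_of_opEigenspace_ne_bot (hμ.opEigenspace_ne_bot j))
      (by rwa [Complex.dist_eq, ← Complex.ofReal_sub, Complex.norm_real, ← dist_eq_norm])
    exact_mod_cast this
  obtain ⟨N, hN⟩ := eventually_atTop.1 hev
  exact (Set.infinite_of_injective_forall_mem (f := fun n => N + n) (add_right_injective N)
    fun n => hN _ (Nat.le_add_right _ _)) (hμ.exists_orthonormalBasis hdisc L).1

/-- The averaged variational principle: for a suitable orthonormal system of eigenvectors, every
trial vector `w` of the form domain satisfies
`z ‖w‖² - ‖∇w‖² ≤ ∑_{μ j < z} (z - μ j) |⟨u j, w⟩|²`. -/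
theorem IsEigenvalueSequence.exists_variational (hμ : IsEigenvalueSequence T μ)
    (hT : ∀ p, p ∈ T.graph ↔ IsWeakSolution ι p) (hι : ∀ w, ‖ι w‖ ≤ ‖w‖)
    (hdisc : HasDiscreteSpectrum T) :
    ∃ u : ℕ → H, (∀ j, ‖u j‖ = 1) ∧ ∀ z : ℝ, 0 < z → ∀ w : K,
      z * ‖ι w‖ ^ 2 - (‖w‖ ^ 2 - ‖ι w‖ ^ 2)
        ≤ ∑ j ∈ (hμ.finite_lt hT hι hdisc z).toFinset, (z - μ j) * ‖inner ℂ (u j) (ι w)‖ ^ 2 := by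
  have hpos : ∀ j, 0 ≤ μ j := fun j =>
    nonneg_of_opEigenspace_ne_bot hT hι (hμ.opEigenspace_ne_bot j)
  choose v hv1 hv2 hv3 using fun x => (hμ.exists_orthonormalBasis hdisc x).2
  let u : ℕ → H := fun j => v (μ j) j
  have hu1 : ∀ j, formResolvent ι (u j) = (1 + μ j)⁻¹ • u j := fun j =>
    (mem_opEigenspace_iff_formResolvent hT (mul_inv_cancel₀ (by have := hpos j; positivity))).1
      (hv1 (μ j) j rfl)
  have hsymm : ∀ x y, inner ℂ (formResolvent ι x) y = inner ℂ x (formResolvent ι y) := by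
    intro x y
    change inner ℂ (ι (ContinuousLinearMap.adjoint ι x)) y
      = inner ℂ x (ι (ContinuousLinearMap.adjoint ι y))
    rw [← ContinuousLinearMap.adjoint_inner_right, ContinuousLinearMap.adjoint_inner_left]
  have hu : Orthonormal ℂ u := by
    rw [orthonormal_iff_ite]
    intro i j
    by_cases hij : μ i = μ j
    · simp only [u, hij]
      exact hv2 (μ j) i j hij rfl
    · have h1 := hsymm (u i) (u j)
      rw [hu1, hu1, ← Complex.coe_smul, ← Complex.coe_smul, inner_smul_left, inner_smul_right,
        Complex.conj_ofReal, ← sub_eq_zero, ← sub_mul, mul_eq_zero] at h1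
      rw [if_neg (by rintro rfl; exact hij rfl)]
      refine h1.resolve_left fun h2 => hij ?_
      rw [sub_eq_zero, Complex.ofReal_inj, inv_inj] at h2
      linarith
  refine ⟨u, hu.1, fun z hz w => ?_⟩
  set s := (hμ.finite_lt hT hι hdisc z).toFinset with hs
  have hmem : ∀ j, j ∈ s ↔ μ j < z := fun j => by simp [hs]
  -- Under `r = (1 + μ)⁻¹`, eigenvalues `μ < z` of `T` correspond to eigenvalues `r > (1 + z)⁻¹` of
  -- the resolvent.
  have hβ : 0 < (1 + z)⁻¹ := by positivity
  have hconv : ∀ r : ℝ, (1 + z)⁻¹ < r → (1 + (r⁻¹ - 1)) * r = 1 ∧ r⁻¹ - 1 < z := by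
    intro r hr
    have hr0 : 0 < r := hβ.trans hr
    refine ⟨by rw [add_sub_cancel, inv_mul_cancel₀ hr0.ne'], ?_⟩
    have := (inv_lt_comm₀ (by positivity) hr0).1 hr
    linarith
  have hiso : ∀ r ∈ spectrum ℝ (formResolvent ι), (1 + z)⁻¹ < r →
      ∃ ε > 0, ∀ t ∈ spectrum ℝ (formResolvent ι), dist t r < ε → t = r := by
    intro r hr hzr
    have hr0 : 0 < r := hβ.trans hzr
    obtain ⟨⟨ε, hε, h⟩, -⟩ := hdisc _ (mem_opSpectrum_of_mem_spectrum_formResolvent hT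
      (hconv r hzr).1 hr)
    have hcont : ContinuousAt (fun t : ℝ => t⁻¹ - 1) r :=
      (continuousAt_inv₀ hr0.ne').sub continuousAt_const
    obtain ⟨δ, hδ, hδ'⟩ := Metric.continuousAt_iff.1 hcont ε hε
    refine ⟨min δ r, lt_min hδ hr0, fun t ht htr => ?_⟩
    have ht0 : 0 < t := by
      have := (abs_lt.1 (lt_of_lt_of_le htr (min_le_right _ _) : |t - r| < r)).1
      linarith
    have h1 := h ((t⁻¹ - 1 : ℝ) : ℂ) (mem_opSpectrum_of_mem_spectrum_formResolvent hT
      (by rw [add_sub_cancel, inv_mul_cancel₀ ht0.ne']) ht) (by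
        rw [Complex.dist_eq, ← Complex.ofReal_sub, Complex.norm_real, ← dist_eq_norm]
        exact hδ' (htr.trans_le (min_le_left _ _)))
    rw [Complex.ofReal_inj, sub_left_inj, inv_inj] at h1
    exact h1
  have key := norm_sq_sub_sum_le ι hβ hiso (J := s) (u := fun j => u j)
    (hu.comp _ Subtype.val_injective) (l := fun j => (1 + μ j)⁻¹)
    (fun j => by have := hpos j; positivity) (fun j => hu1 j) (fun r e hr he => by
      have h1 := (mem_opEigenspace_iff_formResolvent hT (hconv r hr).1).2 he
      refine Submodule.span_mono ?_ (hv3 _ h1)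
      rintro _ ⟨j, hj, rfl⟩
      have hj' : μ j = r⁻¹ - 1 := hj
      refine ⟨⟨j, (hmem j).2 (hj' ▸ (hconv r hr).2)⟩, ?_⟩
      simp only [u, hj']) w
  rw [Finset.sum_coe_sort s fun j => ‖inner ℂ (u j) (ι w)‖ ^ 2,
    Finset.sum_coe_sort s fun j => ((1 + μ j)⁻¹)⁻¹ * ‖inner ℂ (u j) (ι w)‖ ^ 2] at key
  -- After multiplication by `1 + z` the coefficients combine as `(1 + z) - (1 + μ j) = z - μ j`.
  rw [inv_mul_eq_div, le_div_iff₀ (by positivity)] at key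
  have hsum : ∑ j ∈ s, (z - μ j) * ‖inner ℂ (u j) (ι w)‖ ^ 2
      = (1 + z) * ∑ j ∈ s, ‖inner ℂ (u j) (ι w)‖ ^ 2
        - ∑ j ∈ s, ((1 + μ j)⁻¹)⁻¹ * ‖inner ℂ (u j) (ι w)‖ ^ 2 := by
    rw [Finset.mul_sum, ← Finset.sum_sub_distrib]
    refine Finset.sum_congr rfl fun j _ => ?_
    rw [inv_inv]
    ring
  rw [hsum]
  linarith

end EigenvalueSequence

/-! ### The Sobolev space `H¹(Ω)` -/

section Sobolev

variable {d : ℕ} {Ω : Set (EuclideanSpace ℝ (Fin d))}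

lemma exists_clm_eq_integral_smul {ψ : EuclideanSpace ℝ (Fin d) → ℝ}
    (hψ : MemLp ψ 2 (volume.restrict Ω)) :
    ∃ L : L2Space Ω →L[ℂ] ℂ, ∀ u, L u = ∫ x in Ω, ψ x • u x := by
  refine ⟨innerSL ℂ ((hψ.ofReal (K := ℂ)).toLp _), fun u => ?_⟩
  rw [innerSL_apply_apply, MeasureTheory.L2.inner_def]
  refine integral_congr_ae ?_
  filter_upwards [(hψ.ofReal (K := ℂ)).coeFn_toLp] with x hx
  rw [hx]
  simp [mul_comm]

/-- Each defining condition equates two continuous linear functionals. Closedness makes `H¹(Ω)`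
complete, which the adjoint of the embedding requires. -/
lemma isClosed_weakGradientGraph :
    IsClosed (weakGradientGraph Ω : Set (L2Space Ω × (Fin d → L2Space Ω))) := by
  have : (weakGradientGraph Ω : Set (L2Space Ω × (Fin d → L2Space Ω))) =
      ⋂ (i : Fin d) (φ : EuclideanSpace ℝ (Fin d) → ℝ) (_ : IsTestFunction Ω φ),
        {p | ∫ x in Ω, partialDeriv i φ x • p.1 x = - ∫ x in Ω, φ x • p.2 i x} := by
    ext p
    simp only [mem_iInter]
    rfl
  rw [this]
  refine isClosed_iInter fun i => isClosed_iInter fun φ => isClosed_iInter fun hφ => ?_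
  obtain ⟨L, hL⟩ := exists_clm_eq_integral_smul (Ω := Ω)
    ((hφ.continuous_partialDeriv i).memLp_of_hasCompactSupport (p := 2)
      (hφ.hasCompactSupport.fderiv_apply ℝ _))
  obtain ⟨M, hM⟩ := exists_clm_eq_integral_smul (Ω := Ω)
    (hφ.contDiff.continuous.memLp_of_hasCompactSupport (p := 2) hφ.hasCompactSupport)
  simp only [← hL, ← hM]
  exact isClosed_eq (L.continuous.comp continuous_fst)
    (M.continuous.comp ((continuous_apply i).comp continuous_snd)).neg

variable (Ω) in
/-- The graph of the weak gradient, inside the Hilbert space `L²(Ω) × L²(Ω)^d`. -/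
def sobolevSubmodule :
    Submodule ℂ (WithLp 2 (L2Space Ω × PiLp 2 fun _ : Fin d => L2Space Ω)) where
  carrier := {p | (p.fst, fun i => p.snd i) ∈ weakGradientGraph Ω}
  zero_mem' := (weakGradientGraph Ω).zero_mem
  add_mem' h h' := (weakGradientGraph Ω).add_mem h h'
  smul_mem' c _ h := (weakGradientGraph Ω).smul_mem c h

variable (Ω) in
/-- The Sobolev space `H¹(Ω)`, with its Hilbert space norm. -/
def SobolevSpace : Type := sobolevSubmodule Ω

noncomputable instance : NormedAddCommGroup (SobolevSpace Ω) :=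
  inferInstanceAs (NormedAddCommGroup (sobolevSubmodule Ω))

noncomputable instance : InnerProductSpace ℂ (SobolevSpace Ω) :=
  inferInstanceAs (InnerProductSpace ℂ (sobolevSubmodule Ω))

instance : CompleteSpace (SobolevSpace Ω) := by
  have hc := WithLp.prod_continuous_ofLp 2 (L2Space Ω) (PiLp 2 fun _ : Fin d => L2Space Ω)
  have h := isClosed_weakGradientGraph.preimage
    (hc.fst.prodMk (continuous_pi fun i => (PiLp.continuous_apply 2 _ i).comp hc.snd))
  exact (IsClosed.isComplete (s := {p | p ∈ sobolevSubmodule Ω}) h).completeSpace_coe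

/-- The underlying function of an element of `H¹(Ω)`. -/
def SobolevSpace.fn (w : SobolevSpace Ω) : L2Space Ω := w.1.fst

/-- The partial derivatives of an element of `H¹(Ω)`. -/
def SobolevSpace.grad (w : SobolevSpace Ω) (i : Fin d) : L2Space Ω := w.1.snd i

/-- The element of `H¹(Ω)` with given function and gradient. -/
def SobolevSpace.mk {q : L2Space Ω × (Fin d → L2Space Ω)} (hq : q ∈ weakGradientGraph Ω) :
    SobolevSpace Ω :=
  ⟨WithLp.toLp 2 (q.1, WithLp.toLp 2 q.2), hq⟩

lemma SobolevSpace.inner_def (v w : SobolevSpace Ω) :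
    inner ℂ v w = inner ℂ v.fn w.fn + ∑ i, inner ℂ (v.grad i) (w.grad i) := rfl

lemma SobolevSpace.norm_sq (w : SobolevSpace Ω) :
    ‖w‖ ^ 2 = ‖w.fn‖ ^ 2 + ∑ i, ‖w.grad i‖ ^ 2 := by
  have h := SobolevSpace.inner_def w w
  simp only [inner_self_eq_ofReal_norm_sq] at h
  exact_mod_cast h

lemma SobolevSpace.norm_fn_le (w : SobolevSpace Ω) : ‖w.fn‖ ≤ ‖w‖ := by
  refine le_of_sq_le_sq ?_ (norm_nonneg _)
  rw [w.norm_sq]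
  exact le_add_of_nonneg_right (by positivity)

variable (Ω) in
/-- The embedding of `H¹(Ω)` into `L²(Ω)`. -/
noncomputable def sobolevEmbedding : SobolevSpace Ω →L[ℂ] L2Space Ω :=
  LinearMap.mkContinuous
    { toFun := SobolevSpace.fn
      map_add' := fun _ _ => rfl
      map_smul' := fun _ _ => rfl } 1 fun w => by
    rw [one_mul]
    exact w.norm_fn_le

lemma sobolevEmbedding_apply (w : SobolevSpace Ω) : sobolevEmbedding Ω w = w.fn := rfl

/-- The `H¹` inner product exceeds the Dirichlet form by `⟨v, u⟩`; adding this term to both sides of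
the Neumann equation gives the abstract weak equation. -/
lemma mem_graph_neumannLaplacian_iff (hΩ : IsOpen Ω) (p : L2Space Ω × L2Space Ω) :
    p ∈ (neumannLaplacian Ω).graph ↔ IsWeakSolution (sobolevEmbedding Ω) p := by
  rw [neumannLaplacian_graph hΩ]
  constructor
  · rintro ⟨g, hg, h⟩
    refine ⟨SobolevSpace.mk hg, rfl, fun v => ?_⟩
    rw [SobolevSpace.inner_def, inner_add_right, add_comm]
    congr 1
    exact h _ v.2
  · rintro ⟨w, hw, h⟩
    refine ⟨w.grad, hw ▸ w.2, fun q hq => ?_⟩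
    have h1 := h (SobolevSpace.mk hq)
    rw [SobolevSpace.inner_def, inner_add_right, add_comm, ← hw] at h1
    exact add_right_cancel h1

end Sobolev

/-! ### Plane waves -/

section PlaneWave

variable {d : ℕ} {Ω : Set (EuclideanSpace ℝ (Fin d))}

/-- The plane wave `x ↦ exp (2πi ⟨x, ξ⟩)`. -/
noncomputable def planeWave (ξ x : EuclideanSpace ℝ (Fin d)) : ℂ :=
  Complex.exp (2 * Real.pi * Complex.I * (inner ℝ x ξ : ℝ))

lemma norm_planeWave (ξ x : EuclideanSpace ℝ (Fin d)) : ‖planeWave ξ x‖ = 1 := by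
  rw [planeWave, Complex.norm_exp]
  simp

lemma hasFDerivAt_planeWave (ξ x : EuclideanSpace ℝ (Fin d)) :
    HasFDerivAt (planeWave ξ)
      (planeWave ξ x • (2 * Real.pi * Complex.I) •
        (Complex.ofRealCLM ∘L (innerSL ℝ ξ))) x := by
  have h1 : HasFDerivAt (fun y : EuclideanSpace ℝ (Fin d) => ((inner ℝ y ξ : ℝ) : ℂ))
      (Complex.ofRealCLM ∘L (innerSL ℝ ξ)) x := by
    have := (Complex.ofRealCLM ∘L (innerSL ℝ ξ)).hasFDerivAt (x := x)
    refine this.congr_of_eventuallyEq (.of_forall fun y => ?_)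
    simp [real_inner_comm]
  exact (h1.const_mul (2 * Real.pi * Complex.I)).cexp

lemma fderiv_planeWave_single (ξ x : EuclideanSpace ℝ (Fin d)) (i : Fin d) :
    fderiv ℝ (planeWave ξ) x (EuclideanSpace.single i 1)
      = 2 * Real.pi * Complex.I * ξ i * planeWave ξ x := by
  rw [(hasFDerivAt_planeWave ξ x).fderiv]
  simp [EuclideanSpace.inner_single_right]
  ring

lemma continuous_planeWave (ξ : EuclideanSpace ℝ (Fin d)) : Continuous (planeWave ξ) :=
  continuous_iff_continuousAt.2 fun x => (hasFDerivAt_planeWave ξ x).continuousAt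

lemma memLp_planeWave [IsFiniteMeasure (volume.restrict Ω)] (ξ : EuclideanSpace ℝ (Fin d)) :
    MemLp (planeWave ξ) 2 (volume.restrict Ω) :=
  MemLp.of_bound (continuous_planeWave ξ).aestronglyMeasurable 1
    (.of_forall fun x => (norm_planeWave ξ x).le)

/-- Integration by parts against a plane wave. -/
lemma IsTestFunction.integral_partialDeriv_smul_planeWave
    {φ : EuclideanSpace ℝ (Fin d) → ℝ} (hφ : IsTestFunction Ω φ) (i : Fin d)
    (ξ : EuclideanSpace ℝ (Fin d)) :
    ∫ x in Ω, partialDeriv i φ x • planeWave ξ x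
      = - ∫ x in Ω, φ x • (2 * Real.pi * Complex.I * ξ i * planeWave ξ x) := by
  have hsub : ∀ x ∉ Ω, x ∉ tsupport φ := fun x hx h => hx (hφ.tsupport_subset h)
  have hzero : ∀ x ∉ Ω, φ x = 0 := fun x hx => image_eq_zero_of_notMem_tsupport (hsub x hx)
  have hzero' : ∀ x ∉ Ω, partialDeriv i φ x = 0 := fun x hx => by
    rw [partialDeriv, fderiv_of_notMem_tsupport (𝕜 := ℝ) (hsub x hx)]
    rfl
  rw [setIntegral_eq_integral_of_forall_compl_eq_zero (fun x hx => by rw [hzero' x hx, zero_smul]),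
    setIntegral_eq_integral_of_forall_compl_eq_zero (fun x hx => by rw [hzero x hx, zero_smul])]
  have hd : ∀ x, HasFDerivAt (fun y => (φ y : ℂ)) (Complex.ofRealCLM ∘L fderiv ℝ φ x) x := fun x =>
    Complex.ofRealCLM.hasFDerivAt.comp x (hφ.contDiff.differentiable (by simp) x).hasFDerivAt
  have hd' : ∀ x, fderiv ℝ (fun y => (φ y : ℂ)) x (EuclideanSpace.single i 1)
      = (partialDeriv i φ x : ℂ) := fun x => by
    rw [(hd x).fderiv]
    rfl
  have c1 : Continuous fun x => (φ x : ℂ) := Complex.continuous_ofReal.comp hφ.contDiff.continuous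
  have s1 : HasCompactSupport fun x => (φ x : ℂ) :=
    hφ.hasCompactSupport.comp_left (g := Complex.ofReal) Complex.ofReal_zero
  have c2 : Continuous fun x => (partialDeriv i φ x : ℂ) :=
    Complex.continuous_ofReal.comp (hφ.continuous_partialDeriv i)
  have s2 : HasCompactSupport fun x => (partialDeriv i φ x : ℂ) :=
    HasCompactSupport.comp_left (g := Complex.ofReal)
      (hφ.hasCompactSupport.fderiv_apply ℝ (EuclideanSpace.single i 1)) Complex.ofReal_zero
  have c3 := continuous_planeWave ξ
  have h := integral_mul_fderiv_eq_neg_fderiv_mul_of_integrable (μ := volume) (𝕜 := ℂ)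
    (f := planeWave ξ) (g := fun x => (φ x : ℂ)) (v := EuclideanSpace.single i (1 : ℝ))
    (by
      simp only [fderiv_planeWave_single]
      exact ((continuous_const.mul c3).mul c1).integrable_of_hasCompactSupport s1.mul_left)
    (by
      simp only [hd']
      exact (c3.mul c2).integrable_of_hasCompactSupport s2.mul_left)
    ((c3.mul c1).integrable_of_hasCompactSupport s1.mul_left)
    (fun x _ => (hasFDerivAt_planeWave ξ x).differentiableAt)
    (fun x _ => (hd x).differentiableAt)
  simp only [hd', fderiv_planeWave_single] at h
  simp only [Complex.real_smul]
  simp only [mul_comm (planeWave ξ _)] at h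
  rw [h]
  congr 2
  ext x
  ring

variable (Ω) in
/-- The plane wave belongs to `H¹(Ω)`, with the expected norm and Dirichlet integral. -/
lemma exists_planeWave_sobolev [IsFiniteMeasure (volume.restrict Ω)]
    (ξ : EuclideanSpace ℝ (Fin d)) :
    ∃ w : SobolevSpace Ω, w.fn = (memLp_planeWave ξ).toLp _ ∧
      ‖w.fn‖ ^ 2 = vol Ω ∧
      ‖w‖ ^ 2 - ‖w.fn‖ ^ 2 = 4 * Real.pi ^ 2 * ‖ξ‖ ^ 2 * vol Ω := by
  let e : L2Space Ω := (memLp_planeWave ξ).toLp _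
  have he : e =ᵐ[volume.restrict Ω] planeWave ξ := (memLp_planeWave ξ).coeFn_toLp
  let c : Fin d → ℂ := fun i => 2 * Real.pi * Complex.I * ξ i
  have hmem : (e, fun i => c i • e) ∈ weakGradientGraph Ω := by
    intro i φ hφ
    have e1 : ∫ x in Ω, partialDeriv i φ x • e x = ∫ x in Ω, partialDeriv i φ x • planeWave ξ x := by
      refine integral_congr_ae ?_
      filter_upwards [he] with x hx
      rw [hx]
    have e2 : ∫ x in Ω, φ x • (c i • e) x = ∫ x in Ω, φ x • (c i * planeWave ξ x) := by
      refine integral_congr_ae ?_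
      filter_upwards [he, Lp.coeFn_smul (c i) e] with x hx hx'
      rw [hx', Pi.smul_apply, hx, smul_eq_mul]
    exact e1.trans ((hφ.integral_partialDeriv_smul_planeWave i ξ).trans (congrArg Neg.neg e2.symm))
  have hnorm : ‖e‖ ^ 2 = vol Ω := by
    have h1 := MeasureTheory.L2.inner_def (𝕜 := ℂ) e e
    have h2 : ∫ x in Ω, inner ℂ (e x) (e x) = ∫ x in Ω, (1 : ℂ) := by
      refine integral_congr_ae ?_
      filter_upwards [he] with x hx
      rw [hx, inner_self_eq_ofReal_norm_sq, norm_planeWave]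
      simp
    rw [h2, inner_self_eq_ofReal_norm_sq, integral_const, Measure.real, Measure.restrict_apply_univ] at h1
    have h3 : ((‖e‖ ^ 2 : ℝ) : ℂ) = ((vol Ω : ℝ) : ℂ) := by
      rw [h1]
      simp [vol]
    exact_mod_cast h3
  refine ⟨SobolevSpace.mk hmem, rfl, hnorm, ?_⟩
  rw [SobolevSpace.norm_sq, add_sub_cancel_left]
  have hc : ∀ i, ‖c i • e‖ ^ 2 = 4 * Real.pi ^ 2 * (ξ i) ^ 2 * vol Ω := by
    intro i
    rw [norm_smul, mul_pow, hnorm]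
    simp only [c, norm_mul, Complex.norm_I, Complex.norm_real, Complex.norm_ofNat, Real.norm_eq_abs,
      mul_pow, sq_abs]
    ring
  change ∑ i, ‖c i • e‖ ^ 2 = _
  simp only [hc]
  rw [EuclideanSpace.real_norm_sq_eq, ← Finset.sum_mul, ← Finset.mul_sum]

end PlaneWave

/-! ### Riesz means and the phase space bound. -/

section RieszMean

open scoped FourierTransform

variable {d : ℕ} {Ω : Set (EuclideanSpace ℝ (Fin d))}

lemma MeasureTheory.MemLp.integral_norm_sq_eq {α : Type*} [MeasurableSpace α] {ν : Measure α}
    {f : α → ℂ} (hf : MemLp f 2 ν) : ∫ x, ‖f x‖ ^ 2 ∂ν = (eLpNorm f 2 ν).toReal ^ 2 := by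
  have h0 : 0 ≤ ∫ x, ‖f x‖ ^ 2 ∂ν := integral_nonneg fun x => by positivity
  rw [hf.eLpNorm_eq_integral_rpow_norm two_ne_zero ENNReal.ofNat_ne_top]
  simp only [ENNReal.toReal_ofNat, Real.rpow_ofNat]
  rw [ENNReal.toReal_ofReal (by positivity), ← Real.rpow_natCast, ← Real.rpow_mul h0]
  norm_num

/-- Bessel's inequality for the pairing of an `L²` function with plane waves. -/
lemma integrable_and_integral_norm_inner_planeWave_sq [IsFiniteMeasure (volume.restrict Ω)]
    (hΩ : MeasurableSet Ω) (u : L2Space Ω) :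
    Integrable (fun ξ : EuclideanSpace ℝ (Fin d) =>
        ‖inner ℂ u ((memLp_planeWave (Ω := Ω) ξ).toLp _ : L2Space Ω)‖ ^ 2) ∧
      ∫ ξ : EuclideanSpace ℝ (Fin d),
        ‖inner ℂ u ((memLp_planeWave (Ω := Ω) ξ).toLp _ : L2Space Ω)‖ ^ 2 = ‖u‖ ^ 2 := by
  -- Extension of `u` by zero: its Fourier transform at `ξ` is the complex conjugate of `⟨u, e_ξ⟩`.
  -- It is integrable because `Ω` has finite measure.
  let f : EuclideanSpace ℝ (Fin d) → ℂ := Ω.indicator u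
  have hf2 : MemLp f 2 := (memLp_indicator_iff_restrict hΩ).2 (Lp.memLp u)
  have hf1 : Integrable f :=
    (integrable_indicator_iff hΩ).2 ((Lp.memLp u).integrable (by norm_num))
  have hinner : ∀ ξ, ‖inner ℂ u ((memLp_planeWave (Ω := Ω) ξ).toLp _ : L2Space Ω)‖ = ‖𝓕 f ξ‖ := by
    intro ξ
    rw [← inner_conj_symm, RCLike.norm_conj, MeasureTheory.L2.inner_def, Real.fourier_eq]
    congr 1
    have h1 : (fun v => Real.fourierChar (-inner ℝ v ξ) • f v)
        = Ω.indicator fun v => Real.fourierChar (-inner ℝ v ξ) • u v := by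
      ext v
      by_cases hv : v ∈ Ω <;> simp [f, hv]
    rw [h1, integral_indicator hΩ]
    refine integral_congr_ae ?_
    filter_upwards [(memLp_planeWave (Ω := Ω) ξ).coeFn_toLp] with x hx
    rw [hx, Circle.smul_def, Real.fourierChar_apply, planeWave, RCLike.inner_apply,
      ← Complex.exp_conj, smul_eq_mul, mul_comm]
    congr 2
    simp [Complex.conj_ofNat]
    ring
  have hfou := hf2.eLpNorm_fourier_eq hf1
  have hmeas : AEStronglyMeasurable (𝓕 f) volume :=
    (VectorFourier.fourierIntegral_continuous Real.continuous_fourierChar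
      (by exact continuous_inner) hf1).aestronglyMeasurable
  have hF2 : MemLp (𝓕 f) 2 := ⟨hmeas, by rw [hfou]; exact hf2.2⟩
  simp only [hinner]
  refine ⟨hF2.integrable_norm_pow two_ne_zero, ?_⟩
  rw [hF2.integral_norm_sq_eq, hfou, eLpNorm_indicator_eq_eLpNorm_restrict hΩ, Lp.norm_def]

/-- Lower bound for Riesz means of Neumann eigenvalues by a phase space integral. -/
theorem exists_setIntegral_le_sum_sub (hΩ_open : IsOpen Ω) (hΩ_bdd : Bornology.IsBounded Ω)
    (hΩ_disc : HasDiscreteSpectrum (neumannLaplacian Ω))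
    {μ : ℕ → ℝ} (hμ : IsEigenvalueSequence (neumannLaplacian Ω) μ) :
    (∀ j, 0 ≤ μ j) ∧ ∀ z : ℝ, 0 < z → ∃ F : Finset ℕ, (∀ j, j ∈ F ↔ μ j < z) ∧ ∀ ρ : ℝ,
      ∫ ξ in Metric.ball (0 : EuclideanSpace ℝ (Fin d)) ρ,
        vol Ω * (z - 4 * Real.pi ^ 2 * ‖ξ‖ ^ 2) ≤ ∑ j ∈ F, (z - μ j) := by
  have hT := mem_graph_neumannLaplacian_iff hΩ_open
  have hι : ∀ w, ‖sobolevEmbedding Ω w‖ ≤ ‖w‖ := fun w => w.norm_fn_le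
  have : IsFiniteMeasure (volume.restrict Ω) :=
    isFiniteMeasure_restrict.2 hΩ_bdd.measure_lt_top.ne
  refine ⟨fun j => nonneg_of_opEigenspace_ne_bot hT hι (hμ.opEigenspace_ne_bot j),
    fun z hz => ?_⟩
  obtain ⟨u, hu1, hu⟩ := hμ.exists_variational hT hι hΩ_disc
  refine ⟨(hμ.finite_lt hT hι hΩ_disc z).toFinset, fun j => by simp, fun ρ => ?_⟩
  set F := (hμ.finite_lt hT hι hΩ_disc z).toFinset with hF
  have hmem : ∀ j ∈ F, 0 ≤ z - μ j := fun j hj => by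
    have : μ j < z := by simpa [hF] using hj
    linarith
  have hb := fun j => integrable_and_integral_norm_inner_planeWave_sq hΩ_open.measurableSet (u j)
  let g : ℕ → EuclideanSpace ℝ (Fin d) → ℝ := fun j ξ =>
    ‖inner ℂ (u j) ((memLp_planeWave (Ω := Ω) ξ).toLp _ : L2Space Ω)‖ ^ 2
  have hpt : ∀ ξ : EuclideanSpace ℝ (Fin d),
      vol Ω * (z - 4 * Real.pi ^ 2 * ‖ξ‖ ^ 2) ≤ ∑ j ∈ F, (z - μ j) * g j ξ := by
    intro ξ
    obtain ⟨w, hw1, hw2, hw3⟩ := exists_planeWave_sobolev Ω ξ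
    have h := hu z hz w
    simp only [sobolevEmbedding_apply] at h
    rw [hw2] at hw3 h
    rw [hw3, hw1] at h
    linarith
  have hint : IntegrableOn (fun ξ => ∑ j ∈ F, (z - μ j) * g j ξ)
      (Metric.ball (0 : EuclideanSpace ℝ (Fin d)) ρ) :=
    (integrable_finsetSum _ fun j _ => ((hb j).1.const_mul _)).integrableOn
  have hint' : IntegrableOn (fun ξ : EuclideanSpace ℝ (Fin d) =>
      vol Ω * (z - 4 * Real.pi ^ 2 * ‖ξ‖ ^ 2)) (Metric.ball 0 ρ) :=
    ((by fun_prop : Continuous fun ξ : EuclideanSpace ℝ (Fin d) =>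
      vol Ω * (z - 4 * Real.pi ^ 2 * ‖ξ‖ ^ 2)).continuousOn.integrableOn_compact
        (isCompact_closedBall 0 ρ)).mono_set Metric.ball_subset_closedBall
  calc ∫ ξ in Metric.ball (0 : EuclideanSpace ℝ (Fin d)) ρ,
        vol Ω * (z - 4 * Real.pi ^ 2 * ‖ξ‖ ^ 2)
      ≤ ∫ ξ in Metric.ball (0 : EuclideanSpace ℝ (Fin d)) ρ, ∑ j ∈ F, (z - μ j) * g j ξ :=
        setIntegral_mono hint' hint hpt
    _ = ∑ j ∈ F, (z - μ j) * ∫ ξ in Metric.ball (0 : EuclideanSpace ℝ (Fin d)) ρ, g j ξ := by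
        rw [integral_finsetSum _ fun j _ => ((hb j).1.const_mul _).integrableOn]
        exact Finset.sum_congr rfl fun j _ => integral_const_mul _ _
    _ ≤ ∑ j ∈ F, (z - μ j) := by
        -- As `z - μ j ≥ 0`, it suffices that the integral over the ball is at most the one over the
        -- whole space, which is `‖u j‖² = 1`.
        refine Finset.sum_le_sum fun j hj => mul_le_of_le_one_right (hmem j hj) ?_
        refine (setIntegral_le_integral (hb j).1 (.of_forall fun ξ => by positivity)).trans ?_
        rw [(hb j).2, hu1 j, one_pow]

end RieszMean

/-! ### Constants, the phase space integral and the scalar inequality. -/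

section Scalar

lemma unitBallVolume_pos (d : ℕ) : 0 < unitBallVolume d :=
  div_pos (Real.rpow_pos_of_pos Real.pi_pos _) (Real.Gamma_pos_of_pos (by positivity))

lemma classicalConst_pos (d : ℕ) : 0 < classicalConst d :=
  mul_pos (by positivity) (Real.rpow_pos_of_pos (unitBallVolume_pos d) _)

lemma volume_real_ball_eq_unitBallVolume {d : ℕ} (hd : d ≠ 0) :
    volume.real (Metric.ball (0 : EuclideanSpace ℝ (Fin d)) 1) = unitBallVolume d := by
  have : Nonempty (Fin d) := Fin.pos_iff_nonempty.1 (Nat.pos_of_ne_zero hd)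
  have h0 : (0 : ℝ) ≤ √Real.pi ^ d / Real.Gamma ((d : ℝ) / 2 + 1) :=
    div_nonneg (by positivity) (Real.Gamma_pos_of_pos (by positivity)).le
  rw [Measure.real, EuclideanSpace.volume_ball, ENNReal.ofReal_one, one_pow, one_mul,
    Fintype.card_fin, ENNReal.toReal_ofReal h0, unitBallVolume, Real.sqrt_eq_rpow,
    ← Real.rpow_natCast, ← Real.rpow_mul Real.pi_pos.le, add_comm]
  congr 2
  ring

lemma classicalConst_rpow {d : ℕ} (hd : d ≠ 0) :
    classicalConst d ^ (-((d : ℝ) / 2)) = unitBallVolume d / (2 * Real.pi) ^ d := by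
  have hd' : (d : ℝ) ≠ 0 := Nat.cast_ne_zero.2 hd
  rw [classicalConst, Real.mul_rpow (by positivity)
    (Real.rpow_nonneg (unitBallVolume_pos d).le _), ← Real.rpow_mul (unitBallVolume_pos d).le,
    show -(2 / (d : ℝ)) * -((d : ℝ) / 2) = 1 by field_simp, Real.rpow_one,
    show 4 * Real.pi ^ 2 = (2 * Real.pi) ^ (2 : ℝ) by rw [Real.rpow_two]; ring,
    ← Real.rpow_mul (by positivity), show (2 : ℝ) * -((d : ℝ) / 2) = -d by ring,
    Real.rpow_neg (by positivity), Real.rpow_natCast]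
  ring

/-- The phase space volume integral `∫ (z - 4π²|ξ|²)₊ dξ`. -/
lemma setIntegral_ball_sub_norm_sq {d : ℕ} (hd : d ≠ 0) {z : ℝ} (hz : 0 < z) :
    ∫ ξ in Metric.ball (0 : EuclideanSpace ℝ (Fin d)) (√z / (2 * Real.pi)),
        (z - 4 * Real.pi ^ 2 * ‖ξ‖ ^ 2)
      = 2 / ((d : ℝ) + 2) * classicalConst d ^ (-((d : ℝ) / 2)) * z ^ (1 + (d : ℝ) / 2) := by
  have : Nonempty (Fin d) := Fin.pos_iff_nonempty.1 (Nat.pos_of_ne_zero hd)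
  have : Nontrivial (EuclideanSpace ℝ (Fin d)) := by
    refine Module.nontrivial_of_finrank_pos (R := ℝ) ?_
    rw [finrank_euclideanSpace_fin]
    exact Nat.pos_of_ne_zero hd
  -- The integrand vanishes at `|ξ| = ρ`, so the ball is where it is positive; the integral is
  -- evaluated in polar coordinates.
  set ρ := √z / (2 * Real.pi) with hρ
  have hρ0 : 0 < ρ := by positivity
  let f : ℝ → ℝ := (Iio ρ).indicator fun r => z - 4 * Real.pi ^ 2 * r ^ 2
  have h1 : ∫ ξ in Metric.ball (0 : EuclideanSpace ℝ (Fin d)) ρ, (z - 4 * Real.pi ^ 2 * ‖ξ‖ ^ 2)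
      = ∫ ξ : EuclideanSpace ℝ (Fin d), f ‖ξ‖ := by
    rw [← integral_indicator Metric.isOpen_ball.measurableSet]
    congr 1
    ext ξ
    simp only [f, indicator, Metric.mem_ball, dist_zero_right, mem_Iio]
  have h2 : ∫ y in Ioi (0 : ℝ), y ^ (d - 1) • f y
      = ∫ y in (0 : ℝ)..ρ, (z * y ^ (d - 1) - 4 * Real.pi ^ 2 * y ^ (d + 1)) := by
    have e : (fun y => y ^ (d - 1) • f y)
        = (Iio ρ).indicator fun y => z * y ^ (d - 1) - 4 * Real.pi ^ 2 * y ^ (d + 1) := by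
      ext y
      by_cases hy : y ∈ Iio ρ
      · simp only [f, indicator_of_mem hy, smul_eq_mul]
        obtain ⟨k, rfl⟩ := Nat.exists_eq_succ_of_ne_zero hd
        simp only [Nat.succ_eq_add_one, Nat.add_sub_cancel]
        ring
      · simp only [f, indicator_of_notMem hy, smul_zero]
    rw [e, setIntegral_indicator measurableSet_Iio, Ioi_inter_Iio,
      intervalIntegral.integral_of_le hρ0.le, integral_Ioc_eq_integral_Ioo]
  have hd' : (d : ℝ) ≠ 0 := Nat.cast_ne_zero.2 hd
  have h3 : ∫ y in (0 : ℝ)..ρ, (z * y ^ (d - 1) - 4 * Real.pi ^ 2 * y ^ (d + 1))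
      = z * (ρ ^ d / d) - 4 * Real.pi ^ 2 * (ρ ^ (d + 2) / (d + 2)) := by
    rw [intervalIntegral.integral_sub (by apply Continuous.intervalIntegrable; fun_prop)
      (by apply Continuous.intervalIntegrable; fun_prop), intervalIntegral.integral_const_mul,
      intervalIntegral.integral_const_mul, integral_pow, integral_pow,
      Nat.sub_add_cancel (Nat.pos_of_ne_zero hd), Nat.cast_sub (Nat.pos_of_ne_zero hd),
      zero_pow hd, zero_pow (by omega)]
    push_cast
    ring
  have hρ2 : 4 * Real.pi ^ 2 * ρ ^ 2 = z := by
    rw [hρ, div_pow, Real.sq_sqrt hz.le]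
    field_simp
    ring
  rw [h1, integral_fun_norm_addHaar volume f, finrank_euclideanSpace_fin, h2, h3,
    volume_real_ball_eq_unitBallVolume hd, classicalConst_rpow hd, Real.rpow_add hz, Real.rpow_one,
    nsmul_eq_mul, smul_eq_mul, show 4 * Real.pi ^ 2 * (ρ ^ (d + 2) / ((d : ℝ) + 2))
      = (4 * Real.pi ^ 2 * ρ ^ 2) * ρ ^ d / (d + 2) by ring, hρ2,
    show z ^ ((d : ℝ) / 2) = √z ^ d by
      rw [Real.sqrt_eq_rpow, ← Real.rpow_natCast, ← Real.rpow_mul hz.le]; congr 1; ring,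
    hρ, div_pow]
  field_simp
  ring

/-- The elementary inequality behind the quadratic improvement. -/
lemma sum_bound_of_riesz_bound {d : ℕ} (hd : 2 ≤ d) {m s : ℝ} (hm : 0 ≤ m)
    (h : 2 / ((d : ℝ) + 2) * m ^ (1 + (d : ℝ) / 2) ≤ m - s) :
    ((d : ℝ) + 2) / d * s ≤ 1 - (m - 1) ^ 2 := by
  have hd' : (2 : ℝ) ≤ d := by exact_mod_cast hd
  -- Bernoulli: `m ^ (d/2) ≥ 1 + (d/2) (m - 1)`, which is where `d ≥ 2` enters. Substituted into
  -- `h`, it leaves exactly `2 m - m² = 1 - (m - 1)²`.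
  have hB := one_add_mul_self_le_rpow_one_add (s := m - 1) (by linarith) (p := (d : ℝ) / 2)
    (by linarith)
  rw [add_sub_cancel] at hB
  rcases hm.eq_or_lt with rfl | hm
  · rw [Real.zero_rpow (by positivity)] at h
    have : ((d : ℝ) + 2) / d * s ≤ 0 :=
      mul_nonpos_of_nonneg_of_nonpos (by positivity) (by linarith)
    linarith
  rw [Real.rpow_add hm, Real.rpow_one] at h
  have h1 : 2 / ((d : ℝ) + 2) * (m * (1 + d / 2 * (m - 1))) ≤ m - s := by
    refine le_trans ?_ h
    gcongr
  have h2 : ((d : ℝ) + 2) / d * s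
      ≤ ((d : ℝ) + 2) / d * (m - 2 / ((d : ℝ) + 2) * (m * (1 + d / 2 * (m - 1)))) := by
    gcongr
    linarith
  refine h2.trans (le_of_eq ?_)
  field_simp
  ring

end Scalar

/-! ### Bounds for eigenvalue averages and Laplace transforms. -/

section Conclusions

variable {d : ℕ} {Ω : Set (EuclideanSpace ℝ (Fin d))} {μ : ℕ → ℝ}

/-- The lower bound for Riesz means, with the phase space integral evaluated. -/
theorem exists_riesz_mean_bound (hd : d ≠ 0) (hΩ_open : IsOpen Ω) (hΩ_bdd : Bornology.IsBounded Ω)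
    (hΩ_disc : HasDiscreteSpectrum (neumannLaplacian Ω))
    (hμ : IsEigenvalueSequence (neumannLaplacian Ω) μ) {z : ℝ} (hz : 0 < z) :
    ∃ F : Finset ℕ, (∀ j, j ∈ F ↔ μ j < z) ∧
      2 / ((d : ℝ) + 2) * classicalConst d ^ (-((d : ℝ) / 2)) * vol Ω * z ^ (1 + (d : ℝ) / 2)
        ≤ ∑ j ∈ F, (z - μ j) := by
  obtain ⟨F, hF, h⟩ := (exists_setIntegral_le_sum_sub hΩ_open hΩ_bdd hΩ_disc hμ).2 z hz
  refine ⟨F, hF, le_trans (le_of_eq ?_) (h (√z / (2 * Real.pi)))⟩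
  rw [integral_const_mul, setIntegral_ball_sub_norm_sq hd hz]
  ring

/-- The sum of the first `k` eigenvalues is bounded through any `z` between `μ (k - 1)` and
`μ k`. -/
theorem firstAverage_bound (hd : 2 ≤ d) (hΩ_open : IsOpen Ω) (hΩ_bdd : Bornology.IsBounded Ω)
    (hΩ_disc : HasDiscreteSpectrum (neumannLaplacian Ω))
    (hμ : IsEigenvalueSequence (neumannLaplacian Ω) μ) (hV : 0 < vol Ω) {k : ℕ} (hk : 1 ≤ k) {z : ℝ}
    (hz1 : ∀ j < k, μ j ≤ z) (hz2 : ∀ j, k ≤ j → z ≤ μ j) :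
    ((d : ℝ) + 2) / d * (firstAverage μ k / weylTerm Ω k) ≤ 1 - (z / weylTerm Ω k - 1) ^ 2 := by
  have hpos := (exists_setIntegral_le_sum_sub hΩ_open hΩ_bdd hΩ_disc hμ).1
  have hd0 : (0 : ℝ) < d := by exact_mod_cast (by omega : 0 < d)
  have hk0 : (0 : ℝ) < k := by exact_mod_cast hk
  have hC := classicalConst_pos d
  have hW : 0 < weylTerm Ω k := mul_pos hC (by positivity)
  have hz : 0 ≤ z := (hpos 0).trans (hz1 0 hk)
  refine sum_bound_of_riesz_bound hd (div_nonneg hz hW.le) ?_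
  have hsum : ∑ j ∈ Finset.range k, (z - μ j) = k * (z - firstAverage μ k) := by
    rw [Finset.sum_sub_distrib, Finset.sum_const, Finset.card_range, nsmul_eq_mul, firstAverage]
    field_simp
  rcases hz.eq_or_lt with rfl | hz
  -- The Riesz mean bound needs `z > 0`. If `z = 0`, the first `k` eigenvalues all vanish, and so
  -- does their average.
  · rw [zero_div, Real.zero_rpow (by positivity), mul_zero, zero_sub, ← neg_div]
    refine div_nonneg ?_ hW.le
    have h1 : ∑ j ∈ Finset.range k, (0 - μ j) = 0 := Finset.sum_eq_zero fun j hj => by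
      rw [le_antisymm (hz1 j (Finset.mem_range.1 hj)) (hpos j), sub_zero]
    rw [hsum, zero_sub, mul_eq_zero] at h1
    exact (h1.resolve_left hk0.ne').ge
  obtain ⟨F, hF, h⟩ := exists_riesz_mean_bound (by omega) hΩ_open hΩ_bdd hΩ_disc hμ hz
  -- The indices with `μ j < z` are among the first `k`; those left out have `μ j = z` and
  -- contribute zero.
  have hFk : ∑ j ∈ F, (z - μ j) = ∑ j ∈ Finset.range k, (z - μ j) := by
    refine Finset.sum_subset (fun j hj => ?_) fun j hj hjF => ?_
    · rw [Finset.mem_range]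
      by_contra! hkj
      exact absurd ((hF j).1 hj) (hz2 j hkj).not_gt
    · rw [hF, not_lt] at hjF
      rw [le_antisymm (hz1 j (Finset.mem_range.1 hj)) hjF, sub_self]
  rw [hFk, hsum] at h
  -- This normalisation turns the left side of `h` into `2/(d+2) * k * W * (z/W) ^ (1 + d/2)` with
  -- `W = weylTerm Ω k`, so dividing by `k * W` leaves the scalar inequality.
  have hWd : weylTerm Ω k ^ ((d : ℝ) / 2) = classicalConst d ^ ((d : ℝ) / 2) * (k / vol Ω) := by
    rw [weylTerm, Real.mul_rpow hC.le (by positivity), ← Real.rpow_mul (by positivity),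
      show 2 / (d : ℝ) * (d / 2) = 1 by field_simp, Real.rpow_one]
  have hzW : z ^ (1 + (d : ℝ) / 2) = (z / weylTerm Ω k) ^ (1 + (d : ℝ) / 2) *
      (weylTerm Ω k * (classicalConst d ^ ((d : ℝ) / 2) * (k / vol Ω))) := by
    have hWW : weylTerm Ω k * weylTerm Ω k ^ ((d : ℝ) / 2) = weylTerm Ω k ^ (1 + (d : ℝ) / 2) := by
      rw [Real.rpow_add hW, Real.rpow_one]
    rw [← hWd, hWW, ← Real.mul_rpow (by positivity) hW.le, div_mul_cancel₀ _ hW.ne']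
  rw [hzW, Real.rpow_neg hC.le] at h
  have hCd : classicalConst d ^ ((d : ℝ) / 2) ≠ 0 := (Real.rpow_pos_of_pos hC _).ne'
  rw [← sub_div, le_div_iff₀ hW]
  refine le_of_mul_le_mul_left (le_trans (le_of_eq ?_) h) hk0
  field_simp

open Real in
lemma lintegral_rpow_mul_exp_neg {a t : ℝ} (ha : 0 < a) (ht : 0 < t) :
    ∫⁻ y in Ioi (0 : ℝ), ENNReal.ofReal (y ^ (a - 1) * exp (-(t * y)))
      = ENNReal.ofReal ((1 / t) ^ a * Gamma a) := by
  have h := integral_rpow_mul_exp_neg_mul_Ioi ha ht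
  have h0 : 0 < (1 / t) ^ a * Gamma a := mul_pos (by positivity) (Gamma_pos_of_pos ha)
  rw [← h, ofReal_integral_eq_lintegral_ofReal]
  -- The Bochner integral of a non-integrable function is `0`, so a positive value forces
  -- integrability.
  · exact Integrable.of_integral_ne_zero (by rw [h]; exact h0.ne')
  · filter_upwards [ae_restrict_mem measurableSet_Ioi] with y hy
    have : (0 : ℝ) < y := hy
    positivity

/-- The Laplace transform of `z ↦ (z - m)₊`. -/
lemma lintegral_max_sub_mul_exp_neg_le {t : ℝ} (ht : 0 < t) (m : ℝ) :
    ∫⁻ z in Ioi (0 : ℝ), ENNReal.ofReal (max (z - m) 0 * Real.exp (-(t * z)))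
      ≤ ENNReal.ofReal (Real.exp (-(m * t)) / t ^ 2) := by
  -- Enlarging the domain to the whole line allows translation by `m` whatever its sign; only an
  -- upper bound is needed.
  refine (setLIntegral_le_lintegral _ _).trans (le_of_eq ?_)
  rw [← lintegral_add_right_eq_self _ m]
  have h1 : (fun y : ℝ => ENNReal.ofReal (max (y + m - m) 0 * Real.exp (-(t * (y + m)))))
      = (Ioi (0 : ℝ)).indicator fun y => ENNReal.ofReal (Real.exp (-(m * t))) *
          ENNReal.ofReal (y ^ ((2 : ℝ) - 1) * Real.exp (-(t * y))) := by
    ext y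
    by_cases hy : y ∈ Ioi (0 : ℝ)
    · have hy' : (0 : ℝ) < y := hy
      rw [indicator_of_mem hy, ← ENNReal.ofReal_mul (Real.exp_pos _).le, add_sub_cancel_right,
        max_eq_left hy'.le, show (2 : ℝ) - 1 = 1 by norm_num, Real.rpow_one, mul_left_comm,
        ← Real.exp_add]
      congr 3
      ring
    · rw [indicator_of_notMem hy, add_sub_cancel_right, max_eq_right (not_lt.1 hy), zero_mul,
        ENNReal.ofReal_zero]
  rw [h1, lintegral_indicator measurableSet_Ioi, lintegral_const_mul' _ _ ENNReal.ofReal_ne_top,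
    lintegral_rpow_mul_exp_neg two_pos ht, ← ENNReal.ofReal_mul (Real.exp_pos _).le,
    Real.Gamma_two]
  congr 1
  rw [Real.rpow_two]
  ring

end Conclusions

/-- The sequence is indexed from `0`: the `j`-th eigenvalue is `μ (j - 1)`, so that for `1 ≤ k` the
`k`-th and the `(k+1)`-st eigenvalues are `μ (k - 1)` and `μ k`. -/
theorem mainTheorem6 {d : ℕ} (hd : 2 ≤ d) (Ω : Set (EuclideanSpace ℝ (Fin d)))
    (hΩ_open : IsOpen Ω) (hΩ_conn : IsConnected Ω) (hΩ_bdd : Bornology.IsBounded Ω)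
    (hΩ_disc : HasDiscreteSpectrum (neumannLaplacian Ω))
    (μ : ℕ → ℝ) (hμ : IsEigenvalueSequence (neumannLaplacian Ω) μ) :
    (∀ k : ℕ, 1 ≤ k →
      ((d : ℝ) + 2) / d * firstAverage μ k - weylTerm Ω k
        ≤ -weylTerm Ω k * (μ k / weylTerm Ω k - 1) ^ 2) ∧
    (∀ k : ℕ, 1 ≤ k →
      0 ≤ krogerGap Ω μ k ∧
      weylTerm Ω k * (1 - √(krogerGap Ω μ k)) ≤ μ (k - 1) ∧
      μ (k - 1) ≤ μ k ∧
      μ k ≤ weylTerm Ω k * (1 + √(krogerGap Ω μ k))) ∧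
    (∀ z : ℝ, 0 < z →
      Summable (fun j : ℕ => max (z - μ j) 0) ∧
      2 / ((d : ℝ) + 2) * classicalConst d ^ (-((d : ℝ) / 2)) * vol Ω * z ^ (1 + (d : ℝ) / 2)
        ≤ ∑' j : ℕ, max (z - μ j) 0) ∧
    (∀ t : ℝ, 0 < t →
      ENNReal.ofReal (vol Ω / (4 * Real.pi * t) ^ ((d : ℝ) / 2))
        ≤ ∑' j : ℕ, ENNReal.ofReal (Real.exp (-(μ j * t)))) := by
  have hd0 : d ≠ 0 := by omega
  have hV : 0 < vol Ω := ENNReal.toReal_pos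
    (hΩ_open.measure_pos volume hΩ_conn.nonempty).ne' hΩ_bdd.measure_lt_top.ne
  have hW : ∀ k : ℕ, 1 ≤ k → 0 < weylTerm Ω k := fun k hk => by
    have hk0 : (0 : ℝ) < k := by exact_mod_cast hk
    exact mul_pos (classicalConst_pos d) (by positivity)
  -- Both endpoints of `[μ (k - 1), μ k]` are admissible values of `z`: the upper one gives (1) and
  -- the upper bound in (2), the lower one the lower bound in (2).
  have hb1 := fun (k : ℕ) (hk : 1 ≤ k) =>
    firstAverage_bound hd hΩ_open hΩ_bdd hΩ_disc hμ hV hk (z := μ k)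
      (fun j hj => hμ.1 hj.le) (fun j hj => hμ.1 hj)
  have hb2 := fun (k : ℕ) (hk : 1 ≤ k) =>
    firstAverage_bound hd hΩ_open hΩ_bdd hΩ_disc hμ hV hk (z := μ (k - 1))
      (fun j hj => hμ.1 (by omega)) (fun j hj => hμ.1 (by omega))
  have hriesz : ∀ z : ℝ, 0 < z →
      Summable (fun j : ℕ => max (z - μ j) 0) ∧
      2 / ((d : ℝ) + 2) * classicalConst d ^ (-((d : ℝ) / 2)) * vol Ω * z ^ (1 + (d : ℝ) / 2)
        ≤ ∑' j : ℕ, max (z - μ j) 0 := by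
    intro z hz
    obtain ⟨F, hF, h⟩ := exists_riesz_mean_bound hd0 hΩ_open hΩ_bdd hΩ_disc hμ hz
    have hzero : ∀ j ∉ F, max (z - μ j) 0 = 0 := fun j hj => by
      rw [hF, not_lt] at hj
      exact max_eq_right (sub_nonpos.2 hj)
    refine ⟨summable_of_ne_finset_zero hzero, h.trans ?_⟩
    rw [tsum_eq_sum hzero]
    exact Finset.sum_le_sum fun j _ => le_max_left _ _
  have hgap : ∀ k, krogerGap Ω μ k
      = 1 - ((d : ℝ) + 2) / d * (firstAverage μ k / weylTerm Ω k) := fun k => by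
    rw [krogerGap, mul_div_assoc]
  refine ⟨fun k hk => ?_, fun k hk => ?_, hriesz, fun t ht => ?_⟩
  · have h := mul_le_mul_of_nonneg_left (hb1 k hk) (hW k hk).le
    have e : weylTerm Ω k * (((d : ℝ) + 2) / d * (firstAverage μ k / weylTerm Ω k))
        = ((d : ℝ) + 2) / d * firstAverage μ k := by
      have := (hW k hk).ne'
      field_simp
    rw [e] at h
    linarith
  · have h1 : (μ k / weylTerm Ω k - 1) ^ 2 ≤ krogerGap Ω μ k := by
      rw [hgap]; linarith [hb1 k hk]
    have h2 : (μ (k - 1) / weylTerm Ω k - 1) ^ 2 ≤ krogerGap Ω μ k := by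
      rw [hgap]; linarith [hb2 k hk]
    refine ⟨(sq_nonneg _).trans h1, ?_, hμ.1 (Nat.sub_le k 1), ?_⟩
    · have h3 := (abs_le.1 (Real.abs_le_sqrt h2)).1
      rw [mul_comm, ← le_div_iff₀ (hW k hk)]
      linarith
    · have h3 := (abs_le.1 (Real.abs_le_sqrt h1)).2
      rw [mul_comm, ← div_le_iff₀ (hW k hk)]
      linarith
  · set c := 2 / ((d : ℝ) + 2) * classicalConst d ^ (-((d : ℝ) / 2)) * vol Ω with hc
    have hc0 : 0 ≤ c := by
      have := Real.rpow_pos_of_pos (classicalConst_pos d) (-((d : ℝ) / 2))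
      positivity
    -- The exponent `1 + d/2` is written as `(2 + d/2) - 1` to match the Gamma integral.
    have hpt : ∀ z ∈ Ioi (0 : ℝ),
        ENNReal.ofReal c * ENNReal.ofReal (z ^ ((2 + (d : ℝ) / 2) - 1) * Real.exp (-(t * z)))
          ≤ ∑' j, ENNReal.ofReal (max (z - μ j) 0 * Real.exp (-(t * z))) := by
      intro z hz
      obtain ⟨hs, hle⟩ := hriesz z hz
      rw [← ENNReal.ofReal_mul hc0, ← ENNReal.ofReal_tsum_of_nonneg (fun j => by positivity)
        (hs.mul_right _), tsum_mul_right, ← mul_assoc,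
        show (2 + (d : ℝ) / 2) - 1 = 1 + d / 2 by ring]
      exact ENNReal.ofReal_le_ofReal (mul_le_mul_of_nonneg_right hle (Real.exp_pos _).le)
    have hlap : ENNReal.ofReal (c * ((1 / t) ^ (2 + (d : ℝ) / 2) * Real.Gamma (2 + (d : ℝ) / 2)))
        ≤ ∑' j, ENNReal.ofReal (Real.exp (-(μ j * t)) / t ^ 2) := by
      rw [ENNReal.ofReal_mul hc0, ← lintegral_rpow_mul_exp_neg (by positivity) ht,
        ← lintegral_const_mul' _ _ ENNReal.ofReal_ne_top]
      refine (setLIntegral_mono' measurableSet_Ioi hpt).trans ?_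
      -- Tonelli in `[0, ∞]`: no convergence of the heat trace is assumed.
      rw [lintegral_tsum fun j => by fun_prop]
      exact ENNReal.tsum_le_tsum fun j => lintegral_max_sub_mul_exp_neg_le ht (μ j)
    have h2 := mul_le_mul_right hlap (ENNReal.ofReal (t ^ 2))
    rw [← ENNReal.tsum_mul_left, ← ENNReal.ofReal_mul (by positivity)] at h2
    simp only [← ENNReal.ofReal_mul (show (0 : ℝ) ≤ t ^ 2 by positivity)] at h2
    refine le_trans (ENNReal.ofReal_le_ofReal (le_of_eq ?_)) (h2.trans (le_of_eq ?_))
    -- Since `Γ(2 + d/2) = (1 + d/2) Γ(1 + d/2)`, both `2/(d+2)` and the Gamma factor of `ω_d`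
    -- cancel. What remains is `π^{d/2} / (2π)^d = (4π)^{-d/2}` times `|Ω| t^{-d/2}`.
    · have hG : Real.Gamma (1 + (d : ℝ) / 2) ≠ 0 := (Real.Gamma_pos_of_pos (by positivity)).ne'
      rw [hc, classicalConst_rpow hd0, unitBallVolume,
        show 2 + (d : ℝ) / 2 = (1 + (d : ℝ) / 2) + 1 by ring,
        Real.Gamma_add_one (by positivity),
        show (1 + (d : ℝ) / 2) + 1 = 2 + (d : ℝ) / 2 by ring, Real.rpow_add (by positivity),
        Real.rpow_two, one_div, Real.inv_rpow ht.le, Real.mul_rpow (by positivity) ht.le,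
        show 4 * Real.pi = 2 ^ 2 * Real.pi by norm_num, Real.mul_rpow (by positivity) Real.pi_pos.le,
        ← Real.rpow_natCast 2 2, ← Real.rpow_mul (by positivity),
        show ((2 : ℕ) : ℝ) * ((d : ℝ) / 2) = d by push_cast; ring, Real.rpow_natCast, mul_pow]
      have hp : Real.pi ^ d = Real.pi ^ ((d : ℝ) / 2) * Real.pi ^ ((d : ℝ) / 2) := by
        rw [← Real.rpow_add Real.pi_pos, add_halves, Real.rpow_natCast]
      rw [hp]
      field_simp
      ring
    · refine tsum_congr fun j => ?_
      congr 1
      field_simp
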